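/- Let $d\ge 1$ and let $F:\mathbb{R}^3\to\mathbb{R}$ be continuous with $F(0,0,0)=F(x,0,0)=F(0,y,0)=F(0,0,z)=0$ for all $x,y,z\in\mathbb{R}$, and suppose that for all $a_1\le a_2$, $b_1\le b_2$, $c_1\le c_2$ $$F(a_2,b_2,c_2)-F(a_1,b_2,c_2)-F(a_2,b_1,c_2)-F(a_2,b_2,c_1)+F(a_2,b_1,c_1)+F(a_1,b_2,c_1)+F(a_1,b_1,c_2)-F(a_1,b_1,c_1)\ \ge\ 0 .$$ Let $f,g,h:\mathbb{R}^d\to[0,\infty)$ be Lebesgue measurable with finite distribution functions, i.e. $|\{f\ge\lambda\}|,|\{g\ge\lambda\}|,|\{h\ge\lambda\}|<\infty$ for every $\lambda>0$. Assume that the negative parts of the three functions $F(f(s),g(t),0)$, $F(f(s),0,h(s+t))$, $F(0,g(t),h(s+t))$ of $(s,t)$ have finite integral over $\mathbb{R}^d\times\mathbb{R}^d$ (this is automatic if $F\ge 0$ on $[0,\infty)^3$). Then the negative parts of $F(f(s),g(t),h(s+t))$ and $F(f^*(s),g^*(t),h^*(s+t))$ have finite integral as well, so that both integrals below are well defined in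 $(-\infty,\infty]$, and $$\iint_{\mathbb{R}^d\times\mathbb{R}^d} F(f(s),g(t),h(s+t))\,ds\,dt\ \le\ \iint_{\mathbb{R}^d\times\mathbb{R}^d} F(f^*(s),g^*(t),h^*(s+t))\,ds\,dt .$$ Here $f^*$ is the symmetric decreasing rearrangement of $f$: the radially symmetric, radially nonincreasing, lower semicontinuous function for which $\{f^*>\lambda\}$ is, for each $\lambda>0$, the open ball centred at $0$ with $|\{f^*>\lambda\}|=|\{f>\lambda\}|$ (if $f$ is essentially unbounded, its value at the single point $0$ is immaterial). -/

import Mathlib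

open MeasureTheory
open scoped ENNReal

/-- The third-order difference `Δ₃(F; a, b, c, d, e, f)` of `F : ℝ³ → ℝ` over the box
`[a, b] × [c, d] × [e, f]`. -/
def thirdDiff (F : ℝ × ℝ × ℝ → ℝ) (a b c d e f : ℝ) : ℝ :=
  F (b, d, f) - F (a, d, f) - F (b, c, f) - F (b, d, e)
    + F (b, c, e) + F (a, d, e) + F (a, c, f) - F (a, c, e)

/-- `f` has a finite distribution function: every superlevel set of positive height has finite
Lebesgue measure. -/
def FiniteDistribution {d : ℕ} (f : EuclideanSpace ℝ (Fin d) → ℝ) : Prop :=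
  ∀ l : ℝ, 0 < l → volume {x | l ≤ f x} < ∞

/-- The symmetric decreasing rearrangement `f*` of a nonnegative function `f` on `ℝ^d` with finite
distribution function: `f*(x)` is the supremum of the heights `l > 0` such that the open ball
centred at `0` with the measure of `{f > l}` contains `x`, that is, such that the ball of radius
`‖x‖` has measure less than `{f > l}` (and `0` if there is no such height). So `{f* > l}` is, for
every `l ≥ 0`, the open centred ball with the measure of `{f > l}`, which makes `f*` radial,
nonincreasing in `‖x‖`, lower semicontinuous and equimeasurable with `f`. If `f` is essentially
unbounded, this holds away from the point `x = 0`, where the supremum is infinite and the real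
number returned is `0`; for `d ≥ 1` this is a null set. -/
noncomputable def symmRearr {d : ℕ} (f : EuclideanSpace ℝ (Fin d) → ℝ)
    (x : EuclideanSpace ℝ (Fin d)) : ℝ :=
  sSup {l : ℝ | 0 < l ∧ volume (Metric.ball (0 : EuclideanSpace ℝ (Fin d)) ‖x‖)
    < volume {y | l < f y}}

/-- The integral over `X` of the negative part of `φ`. -/
noncomputable def negIntegral {X : Type*} [MeasureSpace X] (φ : X → ℝ) : ℝ≥0∞ :=
  ∫⁻ p, ENNReal.ofReal (-φ p)

/-- The Lebesgue integral of a real function as an extended real number: the integral of the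
positive part minus the integral of the negative part. It is meaningful as soon as one of the two
is finite; wherever it is used, `negIntegral φ < ∞` is stated as well. -/
noncomputable def extIntegral {X : Type*} [MeasureSpace X] (φ : X → ℝ) : EReal :=
  ((∫⁻ p, ENNReal.ofReal (φ p) : ℝ≥0∞) : EReal) - ((negIntegral φ : ℝ≥0∞) : EReal)

/-- The integrand `(s, t) ↦ F(f(s), g(t), h(s + t))` on `ℝ^d × ℝ^d`. -/
def tripleIntegrand {d : ℕ} (F : ℝ × ℝ × ℝ → ℝ) (f g h : EuclideanSpace ℝ (Fin d) → ℝ)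
    (p : EuclideanSpace ℝ (Fin d) × EuclideanSpace ℝ (Fin d)) : ℝ :=
  F (f p.1, g p.2, h (p.1 + p.2))

/-! Since `F` vanishes on the coordinate axes, `F(x,y,z) = F(x,y,0) + F(x,0,z) + F(0,y,z) + Δ₃(F;
0,x,0,y,0,z)`. A measure-preserving shear makes the two arguments of each pair term independent
variables, and each pair term vanishes as soon as one argument is `0`. Its positive and negative
parts therefore have integrals that depend only on the distribution functions, and rearrangement
does not change them (`lintegral_ofReal_tripleIntegrand_zero_symmRearr`). The last term is
nonnegative. Cutting its box into grid cells writes it as a limit of nonnegative combinations of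
products `1{f > k} 1{g > l} 1{h > m}`, so it increases by the Riesz inequality for superlevel sets
(`lintegral_thirdDiff_zero_le`).

The Riesz inequality for sets is proved from scratch. On the line it follows from Pollard's bound `∫
min(1_A * 1_B, t) ≥ t(|A| + |B| - t)`: at `t = (a + b - c)/2` this gives the upper bound `ab - t²`,
which centred intervals attain. Applied to sections, the inequality on the line shows that Steiner
symmetrization in any direction does not decrease the Riesz functional
(`volume_rieszSet_le_steinerSymm`).

Balls are reached without compactness. Let `D` be the total measure of the three sets outside the
balls of equal measure. Symmetrizing in direction `u` lowers `D` by at least a multiple of the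
correlation of the parts outside and inside the balls, integrated along `ℝu`. Averaging over `u` in
polar coordinates yields a direction with gain at least a constant times `D²`
(`exists_symmetrization_step`). Hence the infimum of `D` over all triples with no smaller Riesz
functional is `0`, and for bounded sets the functional exceeds its value at the balls by at most a
constant times `D`. -/

/-! ### Riesz sets and convolutions of indicators -/

section Convolution

variable {G : Type*} [AddCommGroup G]

/-- The pairs `(s, t)` with `s ∈ A`, `t ∈ B` and `s + t ∈ C`. -/
def rieszSet (A B C : Set G) : Set (G × G) := {p | p.1 ∈ A ∧ p.2 ∈ B ∧ p.1 + p.2 ∈ C}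

theorem rieszSet_mono {A A' B B' C C' : Set G} (hA : A ⊆ A') (hB : B ⊆ B') (hC : C ⊆ C') :
    rieszSet A B C ⊆ rieszSet A' B' C' := fun _ h => ⟨hA h.1, hB h.2.1, hC h.2.2⟩

variable [MeasureSpace G]

/-- The convolution of the indicator functions of `A` and `B`. -/
noncomputable def setConv (A B : Set G) (x : G) : ℝ≥0∞ := volume {s | s ∈ A ∧ x - s ∈ B}

theorem setConv_le_left (A B : Set G) (x : G) : setConv A B x ≤ volume A :=
  measure_mono fun _ h => h.1

theorem measurableSet_rieszSet [MeasurableAdd₂ G] {A B C : Set G} (hA : MeasurableSet A)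
    (hB : MeasurableSet B) (hC : MeasurableSet C) : MeasurableSet (rieszSet A B C) :=
  (measurable_fst hA).inter ((measurable_snd hB).inter ((measurable_fst.add measurable_snd) hC))

theorem setConv_le_right [MeasurableAdd₂ G] [MeasurableNeg G]
    [(volume : Measure G).IsAddLeftInvariant] [(volume : Measure G).IsNegInvariant] (A : Set G)
    {B : Set G} (hB : MeasurableSet B) (x : G) :
    setConv A B x ≤ volume B :=
  (measure_mono (t := (fun s => x - s) ⁻¹' B) fun _ h => h.2).trans_eq <|
    (Measure.measurePreserving_sub_left volume x).measure_preimage hB.nullMeasurableSet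

variable [SFinite (volume : Measure G)]

theorem volume_rieszSet_le_mul_left (A B C : Set G) :
    volume (rieszSet A B C) ≤ volume A * volume B := by
  rw [Measure.volume_eq_prod, ← Measure.prod_prod]
  exact measure_mono fun p h => ⟨h.1, h.2.1⟩

theorem volume_rieszSet_swap (A B C : Set G) :
    volume (rieszSet A B C) = volume (rieszSet B A C) := by
  have h := (Measure.measurePreserving_swap (μ := (volume : Measure G))
    (ν := volume)).measure_preimage_equiv
    (f := MeasurableEquiv.prodComm) (rieszSet B A C)
  rw [Measure.volume_eq_prod, ← h]
  congr 1
  ext p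
  change _ ↔ p.2 ∈ B ∧ p.1 ∈ A ∧ p.2 + p.1 ∈ C
  rw [add_comm p.2, and_left_comm]
  rfl

variable [MeasurableSub₂ G]

theorem measurable_setConv {A B : Set G} (hA : MeasurableSet A) (hB : MeasurableSet B) :
    Measurable (setConv A B) := by
  have : MeasurableSet {p : G × G | p.2 ∈ A ∧ p.1 - p.2 ∈ B} :=
    (measurable_snd hA).inter ((measurable_fst.sub measurable_snd) hB)
  exact measurable_measure_prodMk_left this

variable [MeasurableAdd₂ G] [(volume : Measure G).IsAddLeftInvariant]

/-- The shear `(s, t) ↦ (s, s + t)` preserves measure; in the new coordinates the slice at a fixed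
sum is the set measured by the convolution. -/
theorem setLIntegral_setConv {A B C : Set G} (hA : MeasurableSet A) (hB : MeasurableSet B)
    (hC : MeasurableSet C) : ∫⁻ x in C, setConv A B x = volume (rieszSet A B C) := by
  have hm : MeasurableSet {p : G × G | p.1 ∈ A ∧ p.2 - p.1 ∈ B ∧ p.2 ∈ C} :=
    (measurable_fst hA).inter (((measurable_snd.sub measurable_fst) hB).inter (measurable_snd hC))
  have h1 := (measurePreserving_prod_add (volume : Measure G) volume).measure_preimage
    hm.nullMeasurableSet
  have h2 : (fun z : G × G => (z.1, z.1 + z.2)) ⁻¹' {p : G × G | p.1 ∈ A ∧ p.2 - p.1 ∈ B ∧ p.2 ∈ C}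
      = rieszSet A B C := by
    ext p; simp [rieszSet]
  rw [h2] at h1
  rw [Measure.volume_eq_prod, h1, Measure.prod_apply_symm hm, ← lintegral_indicator hC]
  refine lintegral_congr fun x => ?_
  by_cases hx : x ∈ C <;> simp [hx, setConv]

theorem lintegral_setConv {A B : Set G} (hA : MeasurableSet A) (hB : MeasurableSet B) :
    ∫⁻ x, setConv A B x = volume A * volume B := by
  rw [← setLIntegral_univ, setLIntegral_setConv hA hB MeasurableSet.univ, Measure.volume_eq_prod,
    ← Measure.prod_prod]
  congr 1
  ext p; simp [rieszSet]

theorem volume_rieszSet_le_mul_fst {A B C : Set G} (hA : MeasurableSet A) (hB : MeasurableSet B)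
    (hC : MeasurableSet C) : volume (rieszSet A B C) ≤ volume A * volume C := by
  rw [← setLIntegral_setConv hA hB hC]
  calc _ ≤ ∫⁻ x in C, volume A := lintegral_mono fun x => setConv_le_left A B x
    _ = _ := by simp

variable [MeasurableNeg G] [(volume : Measure G).IsNegInvariant]

theorem volume_rieszSet_le_mul_snd {A B C : Set G} (hA : MeasurableSet A) (hB : MeasurableSet B)
    (hC : MeasurableSet C) : volume (rieszSet A B C) ≤ volume B * volume C := by
  rw [← setLIntegral_setConv hA hB hC]
  calc _ ≤ ∫⁻ x in C, volume B := lintegral_mono fun x => setConv_le_right A hB x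
    _ = _ := by simp

end Convolution

/-! ### The Riesz inequality on the real line, by Pollard's inequality -/

section Line

/-- The mass of `B` to the left of `β` is 1-Lipschitz in `β` and runs from `0` to the full mass, so
the intermediate value theorem applies. -/
theorem exists_volume_inter_Iic_eq {B : Set ℝ} {R : ℝ} (hBR : B ⊆ Set.Icc (-R) R)
    {t : ℝ≥0∞} (ht : t ≤ volume B) : ∃ β, volume (B ∩ Set.Iic β) = t := by
  have hBfin : volume B ≠ ∞ :=
    ((measure_mono hBR).trans_lt (by simp [Real.volume_Icc])).ne
  have hfin : ∀ β, volume (B ∩ Set.Iic β) ≠ ∞ := fun β =>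
    measure_ne_top_of_subset Set.inter_subset_left hBfin
  set f : ℝ → ℝ := fun β => (volume (B ∩ Set.Iic β)).toReal with hf
  have hmono : Monotone f := fun x y hxy =>
    ENNReal.toReal_mono (hfin y) (measure_mono fun z hz => ⟨hz.1, hz.2.trans hxy⟩)
  have hstep : ∀ x y, x ≤ y → f y ≤ f x + (y - x) := by
    intro x y hxy
    have h1 : volume (B ∩ Set.Iic y) ≤ volume (B ∩ Set.Iic x) + ENNReal.ofReal (y - x) := by
      rw [← Real.volume_Ioc]
      refine (measure_mono ?_).trans (measure_union_le _ _)
      intro z hz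
      by_cases h : z ≤ x
      · exact Or.inl ⟨hz.1, h⟩
      · exact Or.inr ⟨not_le.1 h, hz.2⟩
    have := ENNReal.toReal_mono (by finiteness [hfin x]) h1
    rwa [ENNReal.toReal_add (hfin x) ENNReal.ofReal_ne_top,
      ENNReal.toReal_ofReal (sub_nonneg.2 hxy)] at this
  have hcont : Continuous f := by
    refine (LipschitzWith.of_dist_le_mul (K := 1) fun x y => ?_).continuous
    rw [Real.dist_eq, Real.dist_eq, NNReal.coe_one, one_mul]
    rcases le_total x y with h | h
    · rw [abs_of_nonpos (sub_nonpos.2 (hmono h)), abs_of_nonpos (sub_nonpos.2 h)]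
      linarith [hstep x y h]
    · rw [abs_of_nonneg (sub_nonneg.2 (hmono h)), abs_of_nonneg (sub_nonneg.2 h)]
      linarith [hstep y x h]
  have h0 : f (-R - 1) = 0 := by
    have : B ∩ Set.Iic (-R - 1) = ∅ := by
      ext z
      simp only [Set.mem_inter_iff, Set.mem_Iic, Set.mem_empty_iff_false, iff_false, not_and]
      intro hz h
      linarith [(hBR hz).1]
    simp [hf, this]
  have h1 : f (max R (-R)) = (volume B).toReal := by
    simp only [hf]
    congr 2
    exact Set.inter_eq_left.2 fun z hz => (hBR hz).2.trans (le_max_left _ _)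
  have htf : t ≠ ∞ := (ht.trans_lt hBfin.lt_top).ne
  have hle : -R - 1 ≤ max R (-R) := by linarith [le_max_right R (-R)]
  obtain ⟨β, -, hβ⟩ := intermediate_value_Icc hle hcont.continuousOn
    (show t.toReal ∈ Set.Icc _ _ by
      rw [h0, h1]; exact ⟨ENNReal.toReal_nonneg, ENNReal.toReal_mono hBfin ht⟩)
  exact ⟨β, (ENNReal.toReal_eq_toReal_iff' (hfin β) htf).1 hβ⟩

theorem exists_volume_inter_Ici_eq {A : Set ℝ} {R : ℝ} (hAR : A ⊆ Set.Icc (-R) R)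
    {t : ℝ≥0∞} (ht : t ≤ volume A) : ∃ α, volume (A ∩ Set.Ici α) = t := by
  have h1 : -A ⊆ Set.Icc (-R) R := fun z hz => by
    have := hAR hz
    exact ⟨by linarith [this.2], by linarith [this.1]⟩
  obtain ⟨β, hβ⟩ := exists_volume_inter_Iic_eq h1 (t := t) (by rwa [Measure.measure_neg])
  refine ⟨-β, ?_⟩
  rw [← hβ, ← Measure.measure_neg]
  congr 1
  ext z
  simp

/-- If `x ≤ α + β`, no `s ≥ α` has `x - s > β`, so the second term vanishes and the first is at most
`|B ∩ Iic β| = t`. If `x > α + β`, then `x - s ≤ β` forces `s > α`, so both terms measure disjoint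
parts of `A ∩ Ici α`, which has measure `t`. -/
theorem setConv_add_setConv_le_min {A B : Set ℝ} (hA : MeasurableSet A) (hB : MeasurableSet B)
    {α β : ℝ} {t : ℝ≥0∞} (hα : volume (A ∩ Set.Ici α) = t) (hβ : volume (B ∩ Set.Iic β) = t)
    (x : ℝ) : setConv A (B ∩ Set.Iic β) x + setConv (A ∩ Set.Ici α) (B ∩ Set.Ioi β) x
      ≤ min (setConv A B x) t := by
  have hdisj : ∀ A₁ A₂ : Set ℝ, Disjoint {s | s ∈ A₁ ∧ x - s ∈ B ∩ Set.Iic β}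
      {s | s ∈ A₂ ∧ x - s ∈ B ∩ Set.Ioi β} := fun A₁ A₂ =>
    Set.disjoint_left.2 fun s h1 h2 => (show x - s ≤ β from h1.2.2).not_gt h2.2.2
  have hsub : Measurable fun s : ℝ => x - s := measurable_const.sub measurable_id
  have hm : MeasurableSet {s | s ∈ A ∩ Set.Ici α ∧ x - s ∈ B ∩ Set.Ioi β} :=
    (hA.inter measurableSet_Ici).inter (hsub (hB.inter measurableSet_Ioi))
  refine le_min ?_ ?_
  · unfold setConv
    rw [← measure_union (hdisj _ _) hm]
    refine measure_mono ?_
    rintro s (h | h)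
    · exact ⟨h.1, h.2.1⟩
    · exact ⟨h.1.1, h.2.1⟩
  · by_cases hx : x ≤ α + β
    · have : setConv (A ∩ Set.Ici α) (B ∩ Set.Ioi β) x = 0 := by
        unfold setConv
        convert measure_empty (μ := (volume : Measure ℝ))
        ext s
        simp only [Set.mem_inter_iff, Set.mem_Ici, Set.mem_Ioi, Set.mem_ofPred_eq,
          Set.mem_empty_iff_false, iff_false]
        rintro ⟨⟨-, h1⟩, -, h2⟩
        linarith
      rw [this, add_zero, ← hβ]
      exact setConv_le_right _ (hB.inter measurableSet_Iic) _
    · unfold setConv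
      rw [← measure_union (hdisj _ _) hm, ← hα]
      refine measure_mono ?_
      rintro s (h | h)
      · have := h.2.2
        simp only [Set.mem_Iic] at this
        exact ⟨h.1, by simp only [Set.mem_Ici]; linarith⟩
      · exact h.1

/-- Pollard's inequality on the real line. -/
theorem mul_add_mul_le_lintegral_min_setConv {A B : Set ℝ} (hA : MeasurableSet A)
    (hB : MeasurableSet B) {R : ℝ} (hAR : A ⊆ Set.Icc (-R) R) (hBR : B ⊆ Set.Icc (-R) R)
    {t : ℝ≥0∞} (htA : t ≤ volume A) (htB : t ≤ volume B) :
    volume A * t + t * (volume B - t) ≤ ∫⁻ x, min (setConv A B x) t := by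
  obtain ⟨β, hβ⟩ := exists_volume_inter_Iic_eq hBR htB
  obtain ⟨α, hα⟩ := exists_volume_inter_Ici_eq hAR htA
  have hBfin : volume B ≠ ∞ :=
    ((measure_mono hBR).trans_lt (by simp [Real.volume_Icc])).ne
  have h1 : volume (B ∩ Set.Ioi β) = volume B - t := by
    rw [← hβ, ← measure_sdiff Set.inter_subset_left (hB.inter measurableSet_Iic).nullMeasurableSet
      (measure_ne_top_of_subset Set.inter_subset_left hBfin)]
    congr 1
    ext z
    simp only [Set.mem_inter_iff, Set.mem_Ioi, Set.mem_sdiff, Set.mem_Iic, not_and, not_le]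
    tauto
  calc volume A * t + t * (volume B - t)
      = ∫⁻ x, (setConv A (B ∩ Set.Iic β) x + setConv (A ∩ Set.Ici α) (B ∩ Set.Ioi β) x) := by
        rw [lintegral_add_left (measurable_setConv hA (hB.inter measurableSet_Iic)),
          lintegral_setConv hA (hB.inter measurableSet_Iic),
          lintegral_setConv (hA.inter measurableSet_Ici) (hB.inter measurableSet_Ioi), hα, hβ, h1]
    _ ≤ _ := lintegral_mono fun x => setConv_add_setConv_le_min hA hB hα hβ x

/-- Pointwise `1_C φ + min(φ, t) ≤ φ + t 1_C` for `φ = 1_A * 1_B`; integrate and use Pollard's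
bound. The additive form avoids truncated subtraction. -/
theorem volume_rieszSet_add_le {A B C : Set ℝ} (hA : MeasurableSet A)
    (hB : MeasurableSet B) (hC : MeasurableSet C) {R : ℝ} (hAR : A ⊆ Set.Icc (-R) R)
    (hBR : B ⊆ Set.Icc (-R) R) {t : ℝ≥0∞} (htA : t ≤ volume A) (htB : t ≤ volume B) :
    volume (rieszSet A B C) + (volume A * t + t * (volume B - t))
      ≤ volume A * volume B + t * volume C := by
  have hm := measurable_setConv hA hB
  calc _ ≤ (∫⁻ x, C.indicator (setConv A B) x) + ∫⁻ x, min (setConv A B x) t := by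
        rw [lintegral_indicator hC, setLIntegral_setConv hA hB hC]
        gcongr
        exact mul_add_mul_le_lintegral_min_setConv hA hB hAR hBR htA htB
    _ = ∫⁻ x, (C.indicator (setConv A B) x + min (setConv A B x) t) :=
        (lintegral_add_left (hm.indicator hC) _).symm
    _ ≤ ∫⁻ x, (setConv A B x + C.indicator (fun _ => t) x) := by
        refine lintegral_mono fun x => ?_
        by_cases hx : x ∈ C
        · simpa [hx] using add_le_add le_rfl (min_le_right _ _)
        · simp [hx]
    _ = _ := by
        rw [lintegral_add_left hm, lintegral_setConv hA hB, lintegral_indicator hC]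
        simp

/-- The open interval of length `a` centred at `0`. -/
def centredInterval (a : ℝ) : Set ℝ := Set.Ioo (-(a / 2)) (a / 2)

theorem measurableSet_centredInterval (a : ℝ) : MeasurableSet (centredInterval a) :=
  measurableSet_Ioo

theorem volume_centredInterval (a : ℝ) : volume (centredInterval a) = ENNReal.ofReal a := by
  rw [centredInterval, Real.volume_Ioo]; congr 1; ring

theorem volume_triangle_le {t : ℝ} (ht : 0 ≤ t) :
    volume {p : ℝ × ℝ | 0 < p.1 ∧ 0 < p.2 ∧ p.1 + p.2 ≤ t} ≤ ENNReal.ofReal (t ^ 2 / 2) := by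
  have hm : MeasurableSet {p : ℝ × ℝ | 0 < p.1 ∧ 0 < p.2 ∧ p.1 + p.2 ≤ t} := by
    refine (measurableSet_lt measurable_const measurable_fst).inter
      ((measurableSet_lt measurable_const measurable_snd).inter
        (measurableSet_le (measurable_fst.add measurable_snd) measurable_const))
  rw [Measure.volume_eq_prod, Measure.prod_apply hm]
  calc _ ≤ ∫⁻ x, (Set.Ioc 0 t).indicator (fun x => ENNReal.ofReal (t - x)) x := by
        refine lintegral_mono fun x => ?_
        by_cases hx : x ∈ Set.Ioc 0 t
        · rw [Set.indicator_of_mem hx]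
          calc _ ≤ volume (Set.Ioc 0 (t - x)) := measure_mono fun y hy => by
                simp only [Set.mem_preimage, Set.mem_ofPred_eq] at hy
                exact ⟨hy.2.1, by linarith [hy.2.2]⟩
            _ = _ := by rw [Real.volume_Ioc, sub_zero]
        · rw [Set.indicator_of_notMem hx, nonpos_iff_eq_zero]
          convert measure_empty (μ := (volume : Measure ℝ))
          ext y
          simp only [Set.mem_preimage, Set.mem_ofPred_eq, Set.mem_empty_iff_false, iff_false]
          rintro ⟨h1, h2, h3⟩
          exact hx ⟨h1, by linarith⟩
    _ = ENNReal.ofReal (∫ x in (0 : ℝ)..t, (t - x)) := by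
        rw [lintegral_indicator measurableSet_Ioc, intervalIntegral.integral_of_le ht,
          ofReal_integral_eq_lintegral_ofReal]
        · exact (intervalIntegrable_iff_integrableOn_Ioc_of_le ht).1
            (Continuous.intervalIntegrable (by fun_prop) _ _)
        · rw [Filter.EventuallyLE, ae_restrict_iff' measurableSet_Ioc]
          exact Filter.Eventually.of_forall fun x hx => sub_nonneg.2 hx.2
    _ = _ := by
        congr 1
        rw [intervalIntegral.integral_sub (by simp) (by simp)]
        simp
        ring

/-- The strip `|x + y| < c/2` leaves uncovered at most two opposite corners of the rectangle, right
triangles with legs `t` and area `t² / 2` each. -/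
theorem ofReal_le_volume_rieszSet_centredInterval {a b c t : ℝ} (ha : 0 ≤ a)
    (ht : 0 ≤ t) (htc : t = (a + b - c) / 2) :
    ENNReal.ofReal (a * b) ≤ volume (rieszSet (centredInterval a) (centredInterval b)
      (centredInterval c)) + ENNReal.ofReal (t ^ 2) := by
  set T : Set (ℝ × ℝ) := {p : ℝ × ℝ | 0 < p.1 ∧ 0 < p.2 ∧ p.1 + p.2 ≤ t}
  have hmT : MeasurableSet T := by
    refine (measurableSet_lt measurable_const measurable_fst).inter
      ((measurableSet_lt measurable_const measurable_snd).inter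
        (measurableSet_le (measurable_fst.add measurable_snd) measurable_const))
  have e1 : MeasurePreserving (fun p : ℝ × ℝ => ((a / 2 - p.1 : ℝ), (b / 2 - p.2 : ℝ)))
      volume volume :=
    (Measure.measurePreserving_sub_left volume (a / 2)).prod
      (Measure.measurePreserving_sub_left volume (b / 2))
  have e2 : MeasurePreserving (fun p : ℝ × ℝ => ((a / 2 + p.1 : ℝ), (b / 2 + p.2 : ℝ)))
      volume volume :=
    (measurePreserving_add_left volume (a / 2)).prod (measurePreserving_add_left volume (b / 2))
  have hsub : centredInterval a ×ˢ centredInterval b ⊆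
      rieszSet (centredInterval a) (centredInterval b) (centredInterval c) ∪
        ((fun p : ℝ × ℝ => ((a / 2 - p.1 : ℝ), (b / 2 - p.2 : ℝ))) ⁻¹' T ∪
        (fun p : ℝ × ℝ => ((a / 2 + p.1 : ℝ), (b / 2 + p.2 : ℝ))) ⁻¹' T) := by
    rintro ⟨x, y⟩ ⟨⟨h1, h2⟩, h3, h4⟩
    simp only at h1 h2 h3 h4
    by_cases h5 : c / 2 ≤ x + y
    · right; left
      exact ⟨by simp only; linarith, by simp only; linarith, by simp only; linarith⟩
    · by_cases h6 : x + y ≤ -(c / 2)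
      · right; right
        exact ⟨by simp only; linarith, by simp only; linarith, by simp only; linarith⟩
      · left
        exact ⟨⟨h1, h2⟩, ⟨h3, h4⟩, not_le.1 h6, not_le.1 h5⟩
  calc ENNReal.ofReal (a * b) = volume (centredInterval a ×ˢ centredInterval b) := by
        rw [Measure.volume_eq_prod, Measure.prod_prod, volume_centredInterval,
          volume_centredInterval, ENNReal.ofReal_mul ha]
    _ ≤ _ := measure_mono hsub
    _ ≤ _ := measure_union_le _ _
    _ ≤ _ := by
        gcongr
        refine (measure_union_le _ _).trans ?_
        rw [e1.measure_preimage hmT.nullMeasurableSet, e2.measure_preimage hmT.nullMeasurableSet]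
        refine (add_le_add (volume_triangle_le ht) (volume_triangle_le ht)).trans_eq ?_
        rw [← ENNReal.ofReal_add (by positivity) (by positivity)]
        congr 1; ring

theorem volume_shear (B C : Set ℝ) (hB : MeasurableSet B) (hC : MeasurableSet C) :
    volume {p : ℝ × ℝ | p.2 ∈ B ∧ p.1 + p.2 ∈ C} = volume B * volume C := by
  have h := (measurePreserving_prod_add_swap_right (volume : Measure ℝ) volume).measure_preimage
    (hB.prod hC).nullMeasurableSet
  rw [Measure.prod_prod] at h
  rw [← h, Measure.volume_eq_prod]
  rfl


/-- When `b + c ≤ a`, the constraints on `y` and `x + y` already force the one on `x`. -/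
theorem mul_le_volume_rieszSet_centredInterval {a b c : ℝ} (hbc : b + c ≤ a) :
    ENNReal.ofReal b * ENNReal.ofReal c ≤ volume (rieszSet (centredInterval a)
      (centredInterval b) (centredInterval c)) := by
  rw [← volume_centredInterval, ← volume_centredInterval,
    ← volume_shear _ _ (measurableSet_centredInterval b) (measurableSet_centredInterval c)]
  refine measure_mono ?_
  rintro ⟨x, y⟩ ⟨⟨h1, h2⟩, h3, h4⟩
  simp only at h1 h2 h3 h4
  exact ⟨⟨by linarith, by linarith⟩, ⟨h1, h2⟩, h3, h4⟩

/-- The Riesz rearrangement inequality for bounded sets on the real line. -/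
theorem volume_rieszSet_le_centredInterval {A B C : Set ℝ} (hA : MeasurableSet A)
    (hB : MeasurableSet B) (hC : MeasurableSet C) {R : ℝ} (hAR : A ⊆ Set.Icc (-R) R)
    (hBR : B ⊆ Set.Icc (-R) R) (hCf : volume C ≠ ∞) :
    volume (rieszSet A B C) ≤ volume (rieszSet (centredInterval (volume A).toReal)
      (centredInterval (volume B).toReal) (centredInterval (volume C).toReal)) := by
  have hAf : volume A ≠ ∞ := ((measure_mono hAR).trans_lt (by simp [Real.volume_Icc])).ne
  have hBf : volume B ≠ ∞ := ((measure_mono hBR).trans_lt (by simp [Real.volume_Icc])).ne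
  obtain ⟨a, ha, hAa⟩ : ∃ a : ℝ, 0 ≤ a ∧ volume A = ENNReal.ofReal a :=
    ⟨_, ENNReal.toReal_nonneg, (ENNReal.ofReal_toReal hAf).symm⟩
  obtain ⟨b, hb, hBb⟩ : ∃ a : ℝ, 0 ≤ a ∧ volume B = ENNReal.ofReal a :=
    ⟨_, ENNReal.toReal_nonneg, (ENNReal.ofReal_toReal hBf).symm⟩
  obtain ⟨c, hc, hCc⟩ : ∃ a : ℝ, 0 ≤ a ∧ volume C = ENNReal.ofReal a :=
    ⟨_, ENNReal.toReal_nonneg, (ENNReal.ofReal_toReal hCf).symm⟩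
  rw [hAa, hBb, hCc, ENNReal.toReal_ofReal ha, ENNReal.toReal_ofReal hb, ENNReal.toReal_ofReal hc]
  by_cases h1 : b + c ≤ a
  · refine (volume_rieszSet_le_mul_snd hA hB hC).trans ?_
    rw [hBb, hCc]
    exact mul_le_volume_rieszSet_centredInterval h1
  by_cases h2 : a + c ≤ b
  · refine (volume_rieszSet_le_mul_fst hA hB hC).trans ?_
    rw [hAa, hCc, volume_rieszSet_swap (centredInterval a)]
    exact mul_le_volume_rieszSet_centredInterval h2
  by_cases h3 : a + b ≤ c
  · refine (volume_rieszSet_le_mul_left A B C).trans ?_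
    rw [hAa, hBb, ← volume_centredInterval, ← volume_centredInterval, ← Measure.prod_prod,
      Measure.volume_eq_prod]
    refine measure_mono ?_
    rintro ⟨x, y⟩ ⟨⟨h1, h2⟩, h3, h4⟩
    simp only at h1 h2 h3 h4
    exact ⟨⟨h1, h2⟩, ⟨h3, h4⟩, by simp only; linarith, by simp only; linarith⟩
  -- This `t` minimises the bound `ab + tc - t(a + b - t)`; the minimum is `ab - t²`, the value for
  -- intervals. Exclusion of the three cases above is what gives `0 ≤ t`, `t ≤ a` and `t ≤ b`.
  set t := (a + b - c) / 2 with htdef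
  have ht : 0 ≤ t := by rw [htdef]; linarith
  have hta : t ≤ a := by rw [htdef]; linarith
  have htb : t ≤ b := by rw [htdef]; linarith
  have hup := volume_rieszSet_add_le hA hB hC hAR hBR (t := ENNReal.ofReal t)
    (hAa ▸ ENNReal.ofReal_le_ofReal hta) (hBb ▸ ENNReal.ofReal_le_ofReal htb)
  have hlow := ofReal_le_volume_rieszSet_centredInterval ha ht htdef
  rw [hAa, hBb, hCc, ← ENNReal.ofReal_sub _ ht, ← ENNReal.ofReal_mul ha, ← ENNReal.ofReal_mul ht,
    ← ENNReal.ofReal_mul ha, ← ENNReal.ofReal_mul ht,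
    ← ENNReal.ofReal_add (mul_nonneg ha ht) (mul_nonneg ht (sub_nonneg.2 htb))] at hup
  have hfin : ENNReal.ofReal (a * t + t * (b - t)) ≠ ∞ := ENNReal.ofReal_ne_top
  refine (ENNReal.add_le_add_iff_right hfin).1 (hup.trans ?_)
  refine (add_le_add_left hlow _).trans_eq ?_
  rw [add_assoc, ← ENNReal.ofReal_add (by positivity) (by positivity)]
  congr 2
  rw [htdef]; ring

end Line

/-! ### Choice of a direction, and coordinates adapted to it -/

section Polar

/-- In polar coordinates some direction does at least as well as the average over the sphere. The
radial weight `r ^ (dim - 1)` is at most `M ^ (dim - 1)` wherever `Φ` does not vanish. -/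
theorem exists_unit_lintegral_ray_ge {E : Type*} [NormedAddCommGroup E] [NormedSpace ℝ E]
    [FiniteDimensional ℝ E] [MeasurableSpace E] [BorelSpace E] [Nontrivial E]
    (μ : Measure E) [μ.IsAddHaarMeasure] {Φ : E → ℝ≥0∞} (hΦ : Measurable Φ)
    (hfin : ∫⁻ w, Φ w ∂μ ≠ ∞) {M : ℝ} (hsupp : ∀ w, M < ‖w‖ → Φ w = 0) :
    ∃ u : E, ‖u‖ = 1 ∧ (∫⁻ w, Φ w ∂μ) / μ.toSphere Set.univ ≤
      ENNReal.ofReal (M ^ (Module.finrank ℝ E - 1)) * ∫⁻ r in Set.Ioi (0 : ℝ), Φ (r • u) := by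
  set n := Module.finrank ℝ E - 1
  set J : Metric.sphere (0 : E) 1 → ℝ≥0∞ :=
    fun u => ∫⁻ r : Set.Ioi (0 : ℝ), Φ ((r : ℝ) • (u : E)) ∂(Measure.volumeIoiPow n) with hJ
  have hmeas : Measurable fun p : Metric.sphere (0 : E) 1 × Set.Ioi (0 : ℝ) =>
      Φ ((p.2 : ℝ) • (p.1 : E)) := by fun_prop
  have hI : ∫⁻ w, Φ w ∂μ = ∫⁻ u, J u ∂μ.toSphere := by
    rw [hJ, lintegral_lintegral hmeas.aemeasurable,
      ← (μ.measurePreserving_homeomorphUnitSphereProd).lintegral_comp hmeas]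
    have h0 : ∫⁻ w, Φ w ∂μ = ∫⁻ w : ({0}ᶜ : Set E), Φ w ∂(μ.comap Subtype.val) := by
      rw [lintegral_subtype_comap (measurableSet_singleton (0 : E)).compl,
        restrict_compl_singleton]
    rw [h0]
    refine lintegral_congr fun a => ?_
    congr 1
    exact (congrArg Subtype.val ((homeomorphUnitSphereProd E).symm_apply_apply a)).symm
  have hne : μ.toSphere ≠ 0 := Measure.toSphere_ne_zero μ
  obtain ⟨u, hu⟩ := exists_laverage_le hne (f := J) (by rwa [← hI])
  refine ⟨u, by simp, ?_⟩
  rw [laverage_eq, ← hI] at hu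
  refine hu.trans ?_
  have hJu : J u = ∫⁻ r in Set.Ioi (0 : ℝ), ENNReal.ofReal (r ^ n) * Φ (r • (u : E)) := by
    rw [hJ]
    simp only
    rw [Measure.volumeIoiPow, lintegral_withDensity_eq_lintegral_mul _ (by fun_prop) (by fun_prop)]
    exact lintegral_subtype_comap measurableSet_Ioi
      fun r : ℝ => ENNReal.ofReal (r ^ n) * Φ (r • (u : E))
  rw [hJu, ← lintegral_const_mul _ (by fun_prop)]
  refine setLIntegral_mono' measurableSet_Ioi fun r hr => ?_
  rcases le_or_gt r M with h | h
  · gcongr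
    exact le_of_lt hr
  · rw [hsupp, mul_zero]
    · exact zero_le
    · rw [norm_smul, norm_eq_of_mem_sphere, mul_one]
      exact h.trans_le (le_abs_self r)

/-- Orthonormal coordinates on `uᗮ ⊕ ℝu`. The product carries the sup norm, so `φ` is not an
isometry and the Euclidean norm is recorded through squares. -/
theorem exists_volumePreserving_linearEquiv_prod {E : Type*} [NormedAddCommGroup E]
    [InnerProductSpace ℝ E] [MeasurableSpace E] [BorelSpace E] [FiniteDimensional ℝ E] {n : ℕ}
    (hn : Module.finrank ℝ E = n + 1) (u : E) (hu : ‖u‖ = 1) :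
    ∃ φ : E ≃ₗ[ℝ] (EuclideanSpace ℝ (Fin n) × ℝ), MeasurePreserving φ volume volume ∧
      (∀ x, ‖x‖ ^ 2 = ‖(φ x).1‖ ^ 2 + (φ x).2 ^ 2) ∧ φ u = (0, 1) := by
  have : Fact (Module.finrank ℝ E = n + 1) := ⟨hn⟩
  set K := Submodule.span ℝ {u}
  have hfr : Module.finrank ℝ Kᗮ = n := Submodule.finrank_orthogonal_span_singleton (by
    rintro rfl; simp at hu)
  set b := (stdOrthonormalBasis ℝ Kᗮ).reindex (finCongr hfr)
  let ψ : E ≃ₗᵢ[ℝ] WithLp 2 (EuclideanSpace ℝ (Fin n) × ℝ) :=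
    (K.orthogonalDecomposition.trans (LinearIsometryEquiv.withLpProdComm 2 ℝ K Kᗮ)).trans
      (LinearIsometryEquiv.withLpProdCongr 2 b.repr
        (LinearIsometryEquiv.toSpanUnitSingleton u hu).symm)
  refine ⟨ψ.toLinearEquiv.trans (WithLp.linearEquiv 2 ℝ _), ?_, ?_, ?_⟩
  · exact (WithLp.volume_preserving_ofLp _ _).comp ψ.measurePreserving
  · intro x
    rw [← ψ.norm_map x, WithLp.prod_norm_sq_eq_of_L2, Real.norm_eq_abs, sq_abs]
    rfl
  · have hmem : u ∈ K := Submodule.mem_span_singleton_self u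
    have hK : K.orthogonalProjectionOnto u = ⟨u, hmem⟩ :=
      K.orthogonalProjectionOnto_mem_subspace_eq_self ⟨u, hmem⟩
    have h1 : K.orthogonalDecomposition u =
        WithLp.toLp 2 (⟨u, hmem⟩, 0) := by
      rw [Submodule.orthogonalDecomposition_apply, hK]
      simpa using hmem
    have h2 : (LinearIsometryEquiv.toSpanUnitSingleton (𝕜 := ℝ) u hu).symm
        ⟨u, hmem⟩ = 1 := by
      rw [LinearIsometryEquiv.symm_apply_eq]
      ext
      simp
    change WithLp.ofLp (ψ u) = _
    simp only [ψ, LinearIsometryEquiv.trans_apply, h1]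
    simpa using h2

end Polar

/-! ### Correlation of two sets under translation -/

section Correlation

variable {G : Type*} [AddCommGroup G] [MeasureSpace G]

/-- The measure of the part of `P` that the translation by `w` moves into `Q`. -/
noncomputable def setCorr (P Q : Set G) (w : G) : ℝ≥0∞ := volume {x | x ∈ P ∧ x + w ∈ Q}

variable [MeasurableAdd₂ G] [SFinite (volume : Measure G)]

theorem measurable_setCorr {P Q : Set G} (hP : MeasurableSet P) (hQ : MeasurableSet Q) :
    Measurable (setCorr P Q) :=
  measurable_measure_prodMk_right
    ((measurable_fst hP).inter ((measurable_fst.add measurable_snd) hQ) :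
      MeasurableSet {p : G × G | p.1 ∈ P ∧ p.1 + p.2 ∈ Q})

theorem lintegral_setCorr [(volume : Measure G).IsAddLeftInvariant] {P Q : Set G}
    (hP : MeasurableSet P) (hQ : MeasurableSet Q) :
    ∫⁻ w, setCorr P Q w = volume P * volume Q := by
  have h := (measurePreserving_prod_add (volume : Measure G) volume).measure_preimage
    (hP.prod hQ).nullMeasurableSet
  rw [Measure.prod_prod] at h
  rw [← h, Measure.prod_apply_symm]
  · rfl
  · exact (measurable_fst hP).inter ((measurable_fst.add measurable_snd) hQ)

end Correlation

/-! ### Steiner symmetrization -/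

section Steiner

variable {V : Type*}

theorem volume_section_le {S : Set (V × ℝ)} {R : ℝ} (hS : ∀ p ∈ S, |p.2| ≤ R) (v : V) :
    volume (Prod.mk v ⁻¹' S) ≤ ENNReal.ofReal (2 * R) := by
  refine (measure_mono (t := Set.Icc (-R) R) fun y hy => abs_le.1 (hS _ hy)).trans_eq ?_
  rw [Real.volume_Icc]; congr 1; ring

theorem volume_section_ne_top {S : Set (V × ℝ)} {R : ℝ} (hS : ∀ p ∈ S, |p.2| ≤ R) (v : V) :
    volume (Prod.mk v ⁻¹' S) ≠ ∞ :=
  ((volume_section_le hS v).trans_lt ENNReal.ofReal_lt_top).ne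

/-- The Steiner symmetrization in the direction of the second coordinate. -/
def steinerSymm (S : Set (V × ℝ)) : Set (V × ℝ) :=
  {p | p.2 ∈ centredInterval (volume (Prod.mk p.1 ⁻¹' S)).toReal}

theorem preimage_steinerSymm (S : Set (V × ℝ)) (v : V) :
    Prod.mk v ⁻¹' steinerSymm S = centredInterval (volume (Prod.mk v ⁻¹' S)).toReal := rfl

theorem volume_preimage_steinerSymm {S : Set (V × ℝ)} {R : ℝ} (hS : ∀ p ∈ S, |p.2| ≤ R) (v : V) :
    volume (Prod.mk v ⁻¹' steinerSymm S) = volume (Prod.mk v ⁻¹' S) := by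
  rw [preimage_steinerSymm, volume_centredInterval, ENNReal.ofReal_toReal
    (volume_section_ne_top hS v)]

theorem centredInterval_mono {a b : ℝ} (h : a ≤ b) : centredInterval a ⊆ centredInterval b :=
  Set.Ioo_subset_Ioo (by linarith) (by linarith)

theorem steinerSymm_mono {S T : Set (V × ℝ)} (hST : S ⊆ T) {R : ℝ} (hT : ∀ p ∈ T, |p.2| ≤ R) :
    steinerSymm S ⊆ steinerSymm T := fun p hp =>
  centredInterval_mono (ENNReal.toReal_mono (volume_section_ne_top hT p.1)
    (measure_mono (Set.preimage_mono hST))) hp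

variable [MeasureSpace V]

theorem measurableSet_steinerSymm {S : Set (V × ℝ)} (hS : MeasurableSet S) :
    MeasurableSet (steinerSymm S) := by
  have hg : Measurable fun p : V × ℝ => (volume (Prod.mk p.1 ⁻¹' S)).toReal :=
    ((measurable_measure_prodMk_left hS).comp measurable_fst).ennreal_toReal
  exact (measurableSet_lt (hg.div_const 2).neg measurable_snd).inter
    (measurableSet_lt measurable_snd (hg.div_const 2))

theorem volume_steinerSymm {S : Set (V × ℝ)} (hm : MeasurableSet S) {R : ℝ}
    (hS : ∀ p ∈ S, |p.2| ≤ R) :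
    volume (steinerSymm S) = volume S := by
  rw [Measure.volume_eq_prod, Measure.prod_apply (measurableSet_steinerSymm hm),
    Measure.prod_apply hm]
  exact lintegral_congr fun v => volume_preimage_steinerSymm hS v

variable [AddCommGroup V] [MeasurableAdd₂ V]

instance measurableAdd₂_prod : MeasurableAdd₂ (V × ℝ) :=
  ⟨by
    have h1 : Measurable fun p : (V × ℝ) × (V × ℝ) => p.1.1 + p.2.1 := by fun_prop
    have h2 : Measurable fun p : (V × ℝ) × (V × ℝ) => p.1.2 + p.2.2 := by fun_prop
    exact h1.prodMk h2⟩

variable [SFinite (volume : Measure V)]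

theorem volume_rieszSet_prod {A B C : Set (V × ℝ)} (hA : MeasurableSet A) (hB : MeasurableSet B)
    (hC : MeasurableSet C) : volume (rieszSet A B C) =
      ∫⁻ v, ∫⁻ w, volume (rieszSet (Prod.mk v ⁻¹' A) (Prod.mk w ⁻¹' B)
        (Prod.mk (v + w) ⁻¹' C)) := by
  have hm := measurableSet_rieszSet hA hB hC
  rw [Measure.volume_eq_prod, Measure.prod_apply hm, Measure.volume_eq_prod,
    lintegral_prod _ (measurable_measure_prodMk_left hm).aemeasurable]
  refine lintegral_congr fun v => ?_
  have h1 : ∀ τ : ℝ, ((volume : Measure V).prod (volume : Measure ℝ))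
      (Prod.mk (v, τ) ⁻¹' rieszSet A B C) =
      ∫⁻ w, volume {σ | (v, τ) ∈ A ∧ (w, σ) ∈ B ∧ (v + w, τ + σ) ∈ C} := fun τ =>
    Measure.prod_apply (measurable_prodMk_left hm)
  have h2 : ∀ w : V, volume (rieszSet (Prod.mk v ⁻¹' A) (Prod.mk w ⁻¹' B) (Prod.mk (v + w) ⁻¹' C))
      = ∫⁻ τ, volume {σ | (v, τ) ∈ A ∧ (w, σ) ∈ B ∧ (v + w, τ + σ) ∈ C} := fun w =>
    Measure.prod_apply (measurableSet_rieszSet (measurable_prodMk_left hA)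
      (measurable_prodMk_left hB) (measurable_prodMk_left hC))
  simp_rw [h1, h2]
  refine lintegral_lintegral_swap (Measurable.aemeasurable ?_)
  have h3 : MeasurableSet {q : (ℝ × V) × ℝ | (v, q.1.1) ∈ A ∧ (q.1.2, q.2) ∈ B ∧
      (v + q.1.2, q.1.1 + q.2) ∈ C} := by
    refine MeasurableSet.inter (hA.preimage ?_) ((hB.preimage ?_).inter (hC.preimage ?_)) <;>
      fun_prop
  exact measurable_measure_prodMk_left h3

/-- Over each pair of base points `(v, w)`, the inequality on the line applies to the three
sections. -/
theorem volume_rieszSet_le_steinerSymm {A B C : Set (V × ℝ)} (hA : MeasurableSet A)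
    (hB : MeasurableSet B) (hC : MeasurableSet C) {R : ℝ} (hAR : ∀ p ∈ A, |p.2| ≤ R)
    (hBR : ∀ p ∈ B, |p.2| ≤ R) (hCR : ∀ p ∈ C, |p.2| ≤ R) :
    volume (rieszSet A B C) ≤
      volume (rieszSet (steinerSymm A) (steinerSymm B) (steinerSymm C)) := by
  rw [volume_rieszSet_prod hA hB hC, volume_rieszSet_prod (measurableSet_steinerSymm hA)
    (measurableSet_steinerSymm hB) (measurableSet_steinerSymm hC)]
  refine lintegral_mono fun v => lintegral_mono fun w => ?_
  exact volume_rieszSet_le_centredInterval (measurable_prodMk_left hA)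
    (measurable_prodMk_left hB) (measurable_prodMk_left hC) (fun y hy => abs_le.1 (hAR _ hy))
    (fun y hy => abs_le.1 (hBR _ hy)) (volume_section_ne_top hCR _)

/-- On one fibre the product of the lengths is the integral of the one-dimensional correlation;
integrating over fibres leaves only translations along the fibre direction. -/
theorem lintegral_volume_mul_volume_section {P Q : Set (V × ℝ)} (hP : MeasurableSet P)
    (hQ : MeasurableSet Q) : ∫⁻ v, volume (Prod.mk v ⁻¹' P) * volume (Prod.mk v ⁻¹' Q) =
      ∫⁻ r : ℝ, setCorr P Q (0, r) := by
  have h1 : ∀ v : V, volume (Prod.mk v ⁻¹' P) * volume (Prod.mk v ⁻¹' Q) =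
      ∫⁻ r : ℝ, volume {τ | (v, τ) ∈ P ∧ (v, τ + r) ∈ Q} := fun v =>
    (lintegral_setCorr (measurable_prodMk_left hP) (measurable_prodMk_left hQ)).symm
  have h2 : ∀ r : ℝ, setCorr P Q (0, r) = ∫⁻ v, volume {τ | (v, τ) ∈ P ∧ (v, τ + r) ∈ Q} := by
    intro r
    unfold setCorr
    rw [Measure.volume_eq_prod, Measure.prod_apply]
    · simp
    · exact hP.inter (hQ.preimage (by fun_prop))
  simp_rw [h1, h2]
  refine lintegral_lintegral_swap (Measurable.aemeasurable ?_)
  have h3 : MeasurableSet {q : (V × ℝ) × ℝ | (q.1.1, q.2) ∈ P ∧ (q.1.1, q.2 + q.1.2) ∈ Q} := by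
    refine MeasurableSet.inter (hP.preimage ?_) (hQ.preimage ?_) <;> fun_prop
  exact measurable_measure_prodMk_left h3

/-- Steiner symmetrization decreases the difference to a symmetric set `D`, quantitatively. -/
theorem volume_steinerSymm_sdiff_add_le {S D : Set (V × ℝ)} (hS : MeasurableSet S)
    (hD : MeasurableSet D) {R : ℝ} (hR : 0 < R) (hSR : ∀ p ∈ S, |p.2| ≤ R)
    (hDR : ∀ p ∈ D, |p.2| ≤ R) (hDD : steinerSymm D = D) :
    volume (steinerSymm S \ D) + (∫⁻ r : ℝ, setCorr (S \ D) (D \ S) (0, r)) / ENNReal.ofReal (2 * R)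
      ≤ volume (S \ D) := by
  have hS' := measurableSet_steinerSymm hS
  rw [← lintegral_volume_mul_volume_section (hS.diff hD) (hD.diff hS), Measure.volume_eq_prod,
    Measure.prod_apply (hS'.diff hD), Measure.prod_apply (hS.diff hD), ENNReal.div_eq_inv_mul,
    ← lintegral_const_mul]
  rotate_left
  · exact (measurable_measure_prodMk_left (hS.diff hD)).mul
      (measurable_measure_prodMk_left (hD.diff hS))
  rw [← lintegral_add_left (measurable_measure_prodMk_left (hS'.diff hD))]
  refine lintegral_mono fun v => ?_
  set p := volume (Prod.mk v ⁻¹' (S \ D)) with hp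
  set q := volume (Prod.mk v ⁻¹' (D \ S)) with hq
  have hSf := volume_section_ne_top hSR v
  have hDf := volume_section_ne_top hDR v
  have hSv : MeasurableSet (Prod.mk v ⁻¹' S) := measurable_prodMk_left hS
  have hDv : MeasurableSet (Prod.mk v ⁻¹' D) := measurable_prodMk_left hD
  -- The sections of `steinerSymm S` and of `D` are centred intervals, hence nested, so only the
  -- positive part of `|S_v| - |D_v| = p - q` remains: the loss on this fibre is `min p q`.
  have h1 : volume (Prod.mk v ⁻¹' (steinerSymm S \ D)) ≤ p - q := by
    have hs : volume (Prod.mk v ⁻¹' S) = volume (Prod.mk v ⁻¹' S ∩ Prod.mk v ⁻¹' D) + p :=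
      (measure_inter_add_sdiff _ hDv).symm
    have hd : volume (Prod.mk v ⁻¹' D) = volume (Prod.mk v ⁻¹' S ∩ Prod.mk v ⁻¹' D) + q := by
      rw [Set.inter_comm]; exact (measure_inter_add_sdiff _ hSv).symm
    have hmf : volume (Prod.mk v ⁻¹' S ∩ Prod.mk v ⁻¹' D) ≠ ∞ :=
      measure_ne_top_of_subset Set.inter_subset_left hSf
    have hpq : p - q = volume (Prod.mk v ⁻¹' S) - volume (Prod.mk v ⁻¹' D) := by
      rw [hs, hd]
      exact (ENNReal.add_sub_add_eq_sub_left hmf).symm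
    rw [hpq]
    nth_rw 1 [← hDD]
    rw [Set.preimage_sdiff, preimage_steinerSymm, preimage_steinerSymm]
    rcases le_total (volume (Prod.mk v ⁻¹' S)) (volume (Prod.mk v ⁻¹' D)) with h | h
    · rw [Set.sdiff_eq_empty.2 (centredInterval_mono (ENNReal.toReal_mono hDf h))]
      simp
    · rw [measure_sdiff (centredInterval_mono (ENNReal.toReal_mono hSf h))
        (measurableSet_centredInterval _).nullMeasurableSet
        (by rw [volume_centredInterval]; exact ENNReal.ofReal_ne_top),
        volume_centredInterval, volume_centredInterval, ENNReal.ofReal_toReal hSf,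
        ENNReal.ofReal_toReal hDf]
  have hpR : p ≤ ENNReal.ofReal (2 * R) := volume_section_le (fun x hx => hSR x hx.1) v
  have hqR : q ≤ ENNReal.ofReal (2 * R) := volume_section_le (fun x hx => hDR x hx.1) v
  have hR0 : ENNReal.ofReal (2 * R) ≠ 0 := by simpa using hR
  -- As `p` and `q` are at most `2R`, the loss `min p q` dominates `pq / (2R)`.
  have hmul : ∀ a b : ℝ≥0∞, b ≤ ENNReal.ofReal (2 * R) →
      (ENNReal.ofReal (2 * R))⁻¹ * (a * b) ≤ a := fun a b hb => by
    calc _ ≤ (ENNReal.ofReal (2 * R))⁻¹ * (a * ENNReal.ofReal (2 * R)) := by gcongr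
      _ = a := by
        rw [mul_comm a, ← mul_assoc, ENNReal.inv_mul_cancel hR0 ENNReal.ofReal_ne_top, one_mul]
  refine (add_le_add_left h1 _).trans ?_
  rcases le_total p q with h | h
  · rw [tsub_eq_zero_of_le h, zero_add]
    exact hmul p q hqR
  · calc _ ≤ p - q + q := by
          gcongr
          rw [mul_comm p]
          exact hmul q p hpR
      _ = p := tsub_add_cancel_of_le h

end Steiner

/-! ### Symmetrization in a given direction, and an abstract descent -/

section RieszSets

theorem volume_rieszSet_preimage {G H : Type*} [AddCommGroup G] [MeasureSpace G]
    [AddCommGroup H] [MeasureSpace H] [MeasurableAdd₂ H] [SFinite (volume : Measure G)]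
    [SFinite (volume : Measure H)] {φ : G →+ H} (hφ : MeasurePreserving φ volume volume)
    {A B C : Set H} (hA : MeasurableSet A) (hB : MeasurableSet B) (hC : MeasurableSet C) :
    volume (rieszSet (φ ⁻¹' A) (φ ⁻¹' B) (φ ⁻¹' C)) = volume (rieszSet A B C) := by
  rw [Measure.volume_eq_prod H, ← (hφ.prod hφ).measure_preimage
    (measurableSet_rieszSet hA hB hC).nullMeasurableSet]
  congr 1
  ext p
  simp [rieszSet]

theorem steinerSymm_ball {V : Type*} [NormedAddCommGroup V] [MeasurableSpace V] (ρ : ℝ) :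
    steinerSymm {p : V × ℝ | ‖p.1‖ ^ 2 + p.2 ^ 2 < ρ ^ 2} =
      {p : V × ℝ | ‖p.1‖ ^ 2 + p.2 ^ 2 < ρ ^ 2} := by
  ext ⟨v, τ⟩
  have h : Prod.mk v ⁻¹' {p : V × ℝ | ‖p.1‖ ^ 2 + p.2 ^ 2 < ρ ^ 2} =
      Set.Ioo (-√(ρ ^ 2 - ‖v‖ ^ 2)) (√(ρ ^ 2 - ‖v‖ ^ 2)) := by
    ext y
    rw [Set.mem_Ioo, ← abs_lt, ← Real.sqrt_sq_eq_abs, Real.sqrt_lt_sqrt_iff (sq_nonneg y)]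
    simp only [Set.mem_preimage, Set.mem_ofPred_eq]
    exact lt_sub_iff_add_lt'.symm
  have h' : (v, τ) ∈ {p : V × ℝ | ‖p.1‖ ^ 2 + p.2 ^ 2 < ρ ^ 2} ↔
    τ ∈ Set.Ioo (-√(ρ ^ 2 - ‖v‖ ^ 2)) (√(ρ ^ 2 - ‖v‖ ^ 2)) := by rw [← h]; rfl
  rw [h']
  change τ ∈ centredInterval (volume (Prod.mk v ⁻¹' _)).toReal ↔ _
  rw [h, Real.volume_Ioo, ENNReal.toReal_ofReal (by linarith [Real.sqrt_nonneg (ρ ^ 2 - ‖v‖ ^ 2)]),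
    centredInterval]
  ring_nf

/-- Steiner symmetrization conjugated by coordinates whose last axis is `u`. Centred balls are fixed
by it, which keeps sets inside the ball of radius `R` and makes the quantitative estimate available
with `D` a ball. -/
theorem exists_symmetrization {n : ℕ} {u : EuclideanSpace ℝ (Fin (n + 1))} (hu : ‖u‖ = 1)
    {R : ℝ} (hR : 0 < R) :
    ∃ T : Set (EuclideanSpace ℝ (Fin (n + 1))) → Set (EuclideanSpace ℝ (Fin (n + 1))),
      (∀ S, MeasurableSet S → S ⊆ Metric.ball 0 R →
        MeasurableSet (T S) ∧ T S ⊆ Metric.ball 0 R ∧ volume (T S) = volume S) ∧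
      (∀ A B C, MeasurableSet A → MeasurableSet B → MeasurableSet C → A ⊆ Metric.ball 0 R →
        B ⊆ Metric.ball 0 R → C ⊆ Metric.ball 0 R →
        volume (rieszSet A B C) ≤ volume (rieszSet (T A) (T B) (T C))) ∧
      (∀ S, MeasurableSet S → S ⊆ Metric.ball 0 R → ∀ ρ, 0 ≤ ρ → ρ ≤ R →
        volume (T S \ Metric.ball 0 ρ) +
          (∫⁻ r : ℝ, setCorr (S \ Metric.ball 0 ρ) (Metric.ball 0 ρ \ S) (r • u)) /
            ENNReal.ofReal (2 * R) ≤ volume (S \ Metric.ball 0 ρ)) := by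
  obtain ⟨φ, hφ, hnorm, hφu⟩ := exists_volumePreserving_linearEquiv_prod (n := n) (by simp) u hu
  have hsymm : Measurable φ.symm :=
    (LinearMap.continuous_of_finiteDimensional φ.symm.toLinearMap).measurable
  have hψ : MeasurePreserving φ.symm volume volume := by
    let e : EuclideanSpace ℝ (Fin (n + 1)) ≃ᵐ EuclideanSpace ℝ (Fin n) × ℝ :=
      ⟨φ.toEquiv, hφ.measurable, hsymm⟩
    exact MeasurePreserving.symm e hφ
  have hball : ∀ ρ, 0 ≤ ρ → φ.symm ⁻¹' Metric.ball 0 ρ =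
      {p : EuclideanSpace ℝ (Fin n) × ℝ | ‖p.1‖ ^ 2 + p.2 ^ 2 < ρ ^ 2} := by
    intro ρ hρ
    ext p
    rw [Set.mem_preimage, mem_ball_zero_iff, ← sq_lt_sq₀ (norm_nonneg _) hρ, hnorm,
      LinearEquiv.apply_symm_apply]
    rfl
  have hballm : ∀ ρ, MeasurableSet (φ.symm ⁻¹' Metric.ball 0 ρ) := fun ρ =>
    hsymm measurableSet_ball
  have hbd : ∀ S : Set (EuclideanSpace ℝ (Fin (n + 1))), S ⊆ Metric.ball 0 R →
      ∀ p ∈ φ.symm ⁻¹' S, |p.2| ≤ R := by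
    intro S hS p hp
    have h : p ∈ φ.symm ⁻¹' Metric.ball 0 R := hS hp
    rw [hball R hR.le] at h
    have h' : ‖p.1‖ ^ 2 + p.2 ^ 2 < R ^ 2 := h
    exact abs_le_of_sq_le_sq (by nlinarith [sq_nonneg ‖p.1‖]) hR.le
  have hDD : ∀ ρ, 0 ≤ ρ → steinerSymm (φ.symm ⁻¹' Metric.ball 0 ρ) = φ.symm ⁻¹' Metric.ball 0 ρ :=
    fun ρ hρ => by rw [hball ρ hρ, steinerSymm_ball]
  have hinv : ∀ S : Set (EuclideanSpace ℝ (Fin (n + 1))), φ ⁻¹' (φ.symm ⁻¹' S) = S := fun S => by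
    ext x; simp
  refine ⟨fun S => φ ⁻¹' steinerSymm (φ.symm ⁻¹' S), ?_, ?_, ?_⟩
  · intro S hS hSR
    refine ⟨hφ.measurable (measurableSet_steinerSymm (hsymm hS)), ?_, ?_⟩
    · have h := Set.preimage_mono (f := φ) (steinerSymm_mono (Set.preimage_mono (f := φ.symm) hSR)
        (hbd _ subset_rfl))
      rwa [hDD R hR.le, hinv] at h
    · rw [hφ.measure_preimage (measurableSet_steinerSymm (hsymm hS)).nullMeasurableSet,
        volume_steinerSymm (hsymm hS) (hbd S hSR), hψ.measure_preimage hS.nullMeasurableSet]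
  · intro A B C hA hB hC hAR hBR hCR
    have h1 := volume_rieszSet_preimage (φ := φ.symm.toLinearMap.toAddMonoidHom) hψ hA hB hC
    have h2 := volume_rieszSet_preimage (φ := φ.toLinearMap.toAddMonoidHom) hφ
      (measurableSet_steinerSymm (hsymm hA)) (measurableSet_steinerSymm (hsymm hB))
      (measurableSet_steinerSymm (hsymm hC))
    refine h1.symm.trans_le (le_trans ?_ h2.symm.le)
    exact volume_rieszSet_le_steinerSymm (hsymm hA) (hsymm hB) (hsymm hC) (hbd A hAR) (hbd B hBR)
      (hbd C hCR)
  · intro S hS hSR ρ hρ hρR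
    have h := volume_steinerSymm_sdiff_add_le (hsymm hS) (hballm ρ) hR (hbd S hSR)
      (hbd _ (Metric.ball_subset_ball hρR)) (hDD ρ hρ)
    have hu' : ∀ r : ℝ, φ.symm (0, r) = r • u := fun r => by
      rw [LinearEquiv.symm_apply_eq, map_smul, hφu]; simp
    have hcorr : ∀ r : ℝ, setCorr (φ.symm ⁻¹' S \ φ.symm ⁻¹' Metric.ball 0 ρ)
        (φ.symm ⁻¹' Metric.ball 0 ρ \ φ.symm ⁻¹' S) (0, r) =
        setCorr (S \ Metric.ball 0 ρ) (Metric.ball 0 ρ \ S) (r • u) := by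
      intro r
      have hm : MeasurableSet {x | x ∈ S \ Metric.ball 0 ρ ∧ x + r • u ∈ Metric.ball 0 ρ \ S} :=
        (hS.diff measurableSet_ball).inter
          ((measurableSet_ball.diff hS).preimage (measurable_id.add_const _))
      unfold setCorr
      rw [← hψ.measure_preimage hm.nullMeasurableSet]
      congr 1
      ext x
      simp only [Set.mem_ofPred_eq, Set.mem_preimage, Set.mem_sdiff, map_add, hu']
    simp_rw [hcorr] at h
    have e1 : volume (φ ⁻¹' steinerSymm (φ.symm ⁻¹' S) \ Metric.ball 0 ρ) =
        volume (steinerSymm (φ.symm ⁻¹' S) \ φ.symm ⁻¹' Metric.ball 0 ρ) := by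
      rw [← hφ.measure_preimage ((measurableSet_steinerSymm (hsymm hS)).diff
        (hballm ρ)).nullMeasurableSet, Set.preimage_sdiff, hinv]
    have e2 : volume (S \ Metric.ball 0 ρ) =
        volume (φ.symm ⁻¹' S \ φ.symm ⁻¹' Metric.ball 0 ρ) := by
      rw [← hψ.measure_preimage (hS.diff measurableSet_ball).nullMeasurableSet, Set.preimage_sdiff]
    rw [e1, e2]
    exact h

/-- A positive infimum `I` is impossible: some `D x` lies below `I + k I²`, yet its successor `y`
gives `I + k I² ≤ D y + k (D x)² ≤ D x`. This replaces a convergent sequence of symmetrizations. -/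
theorem exists_lt_of_forall_exists_add_sq_le {X : Type*} [Nonempty X] {D : X → ℝ≥0∞}
    (hD : ∀ x, D x ≠ ∞) {k : ℝ≥0∞} (hk : k ≠ 0)
    (h : ∀ x, ∃ y, D y + k * D x ^ 2 ≤ D x) {ε : ℝ≥0∞} (hε : 0 < ε) : ∃ x, D x < ε := by
  rw [← iInf_lt_iff]
  by_contra! hle
  set I := ⨅ x, D x
  have hI0 : I ≠ 0 := (hε.trans_le hle).ne'
  have hIfin : I ≠ ∞ := ((iInf_le D (Classical.arbitrary X)).trans_lt (hD _).lt_top).ne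
  have hlt : I < I + k * I ^ 2 :=
    ENNReal.lt_add_right hIfin (mul_ne_zero hk (pow_ne_zero 2 hI0))
  obtain ⟨x, hx⟩ := iInf_lt_iff.1 hlt
  obtain ⟨y, hy⟩ := h x
  have : I + k * I ^ 2 ≤ D x := by
    refine le_trans ?_ hy
    gcongr
    · exact iInf_le D y
    · exact iInf_le D x
  exact absurd hx (not_lt.2 this)

/-- Each term is bounded by the largest; the constant is not optimal, and its value is immaterial.
-/
theorem add_add_sq_le_nine_mul (a b c : ℝ≥0∞) :
    (a + b + c) ^ 2 ≤ 9 * (a ^ 2 + b ^ 2 + c ^ 2) := by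
  have key : ∀ m : ℝ≥0∞, a ≤ m → b ≤ m → c ≤ m → m ^ 2 ≤ a ^ 2 + b ^ 2 + c ^ 2 →
      (a + b + c) ^ 2 ≤ 9 * (a ^ 2 + b ^ 2 + c ^ 2) := fun m ha hb hc hm => by
    calc (a + b + c) ^ 2 ≤ (m + m + m) ^ 2 := by gcongr
      _ = 9 * m ^ 2 := by ring
      _ ≤ _ := by gcongr
  rcases le_total a b with h1 | h1 <;> rcases le_total b c with h2 | h2 <;>
    rcases le_total a c with h3 | h3
  all_goals first
    | exact key c h3 h2 le_rfl le_add_self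
    | exact key b h1 le_rfl h2 (le_add_right le_add_self)
    | exact key a le_rfl h1 h3 (by rw [add_assoc]; exact le_self_add)
    | exact key c (h1.trans h2) h2 le_rfl le_add_self
    | exact key a le_rfl h1 (h2.trans h1) (by rw [add_assoc]; exact le_self_add)

end RieszSets

/-! ### The Riesz inequality for sets in `ℝ^(n+1)` -/

section RieszSets

variable {n : ℕ}

/-- Equal volumes make `S \ D` and `D \ S` equally large, so the total correlation is a square. This
is the source of the quadratic gain. -/
theorem lintegral_setCorr_sdiff {G : Type*} [AddCommGroup G] [MeasureSpace G] [MeasurableAdd₂ G]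
    [SFinite (volume : Measure G)] [(volume : Measure G).IsAddLeftInvariant] {S D : Set G}
    (hS : MeasurableSet S) (hD : MeasurableSet D) (h : volume S = volume D)
    (hfin : volume S ≠ ∞) :
    ∫⁻ w, setCorr (S \ D) (D \ S) w = volume (S \ D) ^ 2 := by
  have h1 : volume (D \ S) = volume (S \ D) := by
    have e1 := measure_inter_add_sdiff (μ := volume) S hD
    have e2 := measure_inter_add_sdiff (μ := volume) D hS
    rw [← h, ← e1, Set.inter_comm] at e2
    exact (ENNReal.add_right_inj (measure_ne_top_of_subset Set.inter_subset_left hfin)).1 e2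
  rw [lintegral_setCorr (hS.diff hD) (hD.diff hS), h1, sq]

theorem setCorr_eq_zero {E : Type*} [NormedAddCommGroup E] [MeasureSpace E] {P Q : Set E} {R : ℝ}
    (hP : P ⊆ Metric.ball 0 R) (hQ : Q ⊆ Metric.ball 0 R) {w : E} (hw : 2 * R < ‖w‖) :
    setCorr P Q w = 0 := by
  unfold setCorr
  convert measure_empty (μ := (volume : Measure E))
  ext x
  simp only [Set.mem_ofPred_eq, Set.mem_empty_iff_false, iff_false]
  rintro ⟨h1, h2⟩
  have h1' := mem_ball_zero_iff.1 (hP h1)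
  have h2' := mem_ball_zero_iff.1 (hQ h2)
  have : ‖w‖ ≤ ‖x + w‖ + ‖x‖ := by simpa using norm_sub_le (x + w) x
  linarith

/-- One symmetrization step brings three sets closer to balls at a uniform rate. -/
theorem exists_symmetrization_step {R : ℝ} (hR : 0 < R) :
    ∃ k : ℝ≥0∞, k ≠ 0 ∧ ∀ a b c : ℝ, 0 ≤ a → a ≤ R → 0 ≤ b → b ≤ R → 0 ≤ c → c ≤ R →
      ∀ A B C : Set (EuclideanSpace ℝ (Fin (n + 1))),
      MeasurableSet A → MeasurableSet B → MeasurableSet C →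
      A ⊆ Metric.ball 0 R → B ⊆ Metric.ball 0 R → C ⊆ Metric.ball 0 R →
      volume A = volume (Metric.ball (0 : EuclideanSpace ℝ (Fin (n + 1))) a) →
      volume B = volume (Metric.ball (0 : EuclideanSpace ℝ (Fin (n + 1))) b) →
      volume C = volume (Metric.ball (0 : EuclideanSpace ℝ (Fin (n + 1))) c) →
      ∃ T : Set (EuclideanSpace ℝ (Fin (n + 1))) → Set (EuclideanSpace ℝ (Fin (n + 1))),
      (∀ S, MeasurableSet S → S ⊆ Metric.ball 0 R →
        MeasurableSet (T S) ∧ T S ⊆ Metric.ball 0 R ∧ volume (T S) = volume S) ∧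
      volume (rieszSet A B C) ≤ volume (rieszSet (T A) (T B) (T C)) ∧
      volume (T A \ Metric.ball 0 a) + volume (T B \ Metric.ball 0 b) +
          volume (T C \ Metric.ball 0 c) +
        k * (volume (A \ Metric.ball 0 a) ^ 2 + volume (B \ Metric.ball 0 b) ^ 2 +
          volume (C \ Metric.ball 0 c) ^ 2) ≤
      volume (A \ Metric.ball 0 a) + volume (B \ Metric.ball 0 b) +
          volume (C \ Metric.ball 0 c) := by
  let E := EuclideanSpace ℝ (Fin (n + 1))
  set σ := (volume : Measure E).toSphere Set.univ with hσ
  set M := ENNReal.ofReal ((2 * R) ^ (Module.finrank ℝ E - 1)) with hM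
  have hσ0 : σ ≠ 0 := by
    rw [hσ, Ne, Measure.measure_univ_eq_zero]
    exact Measure.toSphere_ne_zero _
  have hσt : σ ≠ ∞ := measure_ne_top _ _
  have hM0 : M ≠ 0 := by
    rw [hM, Ne, ENNReal.ofReal_eq_zero, not_le]; positivity
  have hR0 : ENNReal.ofReal (2 * R) ≠ 0 := by
    rw [Ne, ENNReal.ofReal_eq_zero, not_le]; positivity
  -- The factor `σ` comes from averaging over the sphere, `M` from bounding the polar weight on `‖w‖
  -- ≤ 2R`, and `2R` from the Steiner estimate.
  refine ⟨(σ * M * ENNReal.ofReal (2 * R))⁻¹, ENNReal.inv_ne_zero.2 (by finiteness), ?_⟩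
  intro a b c ha haR hb hbR hc hcR A B C hA hB hC hAR hBR hCR hAa hBb hCc
  have hfin : ∀ S : Set E, S ⊆ Metric.ball 0 R → volume S ≠ ∞ := fun S hS =>
    ((measure_mono hS).trans_lt measure_ball_lt_top).ne
  have hmc : ∀ S : Set E, MeasurableSet S → ∀ ρ : ℝ,
      Measurable (setCorr (S \ Metric.ball 0 ρ) (Metric.ball 0 ρ \ S)) := fun S hS ρ =>
    measurable_setCorr (hS.diff measurableSet_ball) (measurableSet_ball.diff hS)
  have hz : ∀ S : Set E, S ⊆ Metric.ball 0 R → ∀ ρ : ℝ, ρ ≤ R → ∀ w : E, 2 * R < ‖w‖ →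
      setCorr (S \ Metric.ball 0 ρ) (Metric.ball 0 ρ \ S) w = 0 := fun S hS ρ hρ w hw =>
    setCorr_eq_zero (Set.sdiff_subset.trans hS)
      (Set.sdiff_subset.trans (Metric.ball_subset_ball hρ)) hw
  have hδf : ∀ S : Set E, S ⊆ Metric.ball 0 R → ∀ ρ : ℝ, volume (S \ Metric.ball 0 ρ) ≠ ∞ :=
    fun S hS ρ => hfin _ (Set.sdiff_subset.trans hS)
  -- The three sets must be symmetrized in one common direction, so the average is taken of the sum
  -- of the three correlations.
  set Φ : E → ℝ≥0∞ := fun w => setCorr (A \ Metric.ball 0 a) (Metric.ball 0 a \ A) w +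
    setCorr (B \ Metric.ball 0 b) (Metric.ball 0 b \ B) w +
    setCorr (C \ Metric.ball 0 c) (Metric.ball 0 c \ C) w with hΦ
  have hΦm : Measurable Φ := ((hmc A hA a).add (hmc B hB b)).add (hmc C hC c)
  have hΦint : ∫⁻ w, Φ w = volume (A \ Metric.ball 0 a) ^ 2 + volume (B \ Metric.ball 0 b) ^ 2 +
      volume (C \ Metric.ball 0 c) ^ 2 := by
    have m1 := hmc A hA a
    have m2 := hmc B hB b
    simp only [hΦ]
    rw [lintegral_add_left (by fun_prop), lintegral_add_left m1,
      lintegral_setCorr_sdiff hA measurableSet_ball hAa (hfin A hAR),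
      lintegral_setCorr_sdiff hB measurableSet_ball hBb (hfin B hBR),
      lintegral_setCorr_sdiff hC measurableSet_ball hCc (hfin C hCR)]
  have hΦfin : ∫⁻ w, Φ w ≠ ∞ := by
    rw [hΦint]
    have h1 := hδf A hAR a
    have h2 := hδf B hBR b
    have h3 := hδf C hCR c
    finiteness
  obtain ⟨u, hu, hΦu⟩ := exists_unit_lintegral_ray_ge volume hΦm hΦfin (M := 2 * R) fun w hw => by
    simp only [hΦ, hz A hAR a haR w hw, hz B hBR b hbR w hw, hz C hCR c hcR w hw, add_zero]
  obtain ⟨T, hT1, hT2, hT3⟩ := exists_symmetrization hu hR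
  refine ⟨T, hT1, hT2 A B C hA hB hC hAR hBR hCR, ?_⟩
  have hr : Measurable fun r : ℝ => r • u := measurable_id.smul_const u
  have hsum : ∫⁻ r : ℝ, Φ (r • u) =
      (∫⁻ r : ℝ, setCorr (A \ Metric.ball 0 a) (Metric.ball 0 a \ A) (r • u)) +
      (∫⁻ r : ℝ, setCorr (B \ Metric.ball 0 b) (Metric.ball 0 b \ B) (r • u)) +
      ∫⁻ r : ℝ, setCorr (C \ Metric.ball 0 c) (Metric.ball 0 c \ C) (r • u) := by
    have m1 := hmc A hA a
    have m2 := hmc B hB b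
    rw [← lintegral_add_left (by fun_prop), ← lintegral_add_left (by fun_prop)]
  have hk : (σ * M * ENNReal.ofReal (2 * R))⁻¹ * (∫⁻ w, Φ w) ≤
      (∫⁻ r : ℝ, Φ (r • u)) / ENNReal.ofReal (2 * R) := by
    have h1 : (∫⁻ w, Φ w) ≤ σ * M * ∫⁻ r : ℝ, Φ (r • u) := by
      have h2 := (ENNReal.div_le_iff hσ0 hσt).1 hΦu
      refine h2.trans ?_
      rw [mul_comm _ σ, ← mul_assoc]
      gcongr
      exact Measure.restrict_le_self
    rw [ENNReal.mul_inv (Or.inr ENNReal.ofReal_ne_top) (Or.inr hR0), ENNReal.div_eq_inv_mul,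
      mul_comm (σ * M)⁻¹, mul_assoc]
    gcongr
    have hσM0 : σ * M ≠ 0 := mul_ne_zero hσ0 hM0
    have hσMt : σ * M ≠ ∞ := by finiteness
    rw [← ENNReal.div_eq_inv_mul]
    refine ENNReal.div_le_of_le_mul ?_
    rwa [mul_comm]
  rw [← hΦint]
  refine (add_le_add_right hk _).trans ?_
  rw [hsum, ENNReal.add_div, ENNReal.add_div]
  refine le_trans (le_of_eq ?_) (add_le_add (add_le_add (hT3 A hA hAR a ha haR)
    (hT3 B hB hBR b hb hbR)) (hT3 C hC hCR c hc hcR))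
  ring

/-- The Riesz rearrangement inequality for bounded sets. -/
theorem volume_rieszSet_le_ball_of_subset_ball {R : ℝ} (hR : 0 < R) {a b c : ℝ}
    (ha : 0 ≤ a) (haR : a ≤ R) (hb : 0 ≤ b) (hbR : b ≤ R) (hc : 0 ≤ c) (hcR : c ≤ R)
    {A B C : Set (EuclideanSpace ℝ (Fin (n + 1)))} (hA : MeasurableSet A) (hB : MeasurableSet B)
    (hC : MeasurableSet C) (hAR : A ⊆ Metric.ball 0 R) (hBR : B ⊆ Metric.ball 0 R)
    (hCR : C ⊆ Metric.ball 0 R)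
    (hAa : volume A = volume (Metric.ball (0 : EuclideanSpace ℝ (Fin (n + 1))) a))
    (hBb : volume B = volume (Metric.ball (0 : EuclideanSpace ℝ (Fin (n + 1))) b))
    (hCc : volume C = volume (Metric.ball (0 : EuclideanSpace ℝ (Fin (n + 1))) c)) :
    volume (rieszSet A B C) ≤
      volume (rieszSet (Metric.ball (0 : EuclideanSpace ℝ (Fin (n + 1))) a) (Metric.ball 0 b)
        (Metric.ball 0 c)) := by
  let E := EuclideanSpace ℝ (Fin (n + 1))
  -- All triples with the prescribed volumes inside the ball of radius `R` and with no smaller Riesz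
  -- functional. Each symmetrization step stays in this class, so the descent lemma applies to it.
  let X := {S : Set E × Set E × Set E // (MeasurableSet S.1 ∧ S.1 ⊆ Metric.ball 0 R ∧
      volume S.1 = volume (Metric.ball (0 : E) a)) ∧
    (MeasurableSet S.2.1 ∧ S.2.1 ⊆ Metric.ball 0 R ∧
      volume S.2.1 = volume (Metric.ball (0 : E) b)) ∧
    (MeasurableSet S.2.2 ∧ S.2.2 ⊆ Metric.ball 0 R ∧
      volume S.2.2 = volume (Metric.ball (0 : E) c)) ∧
    volume (rieszSet A B C) ≤ volume (rieszSet S.1 S.2.1 S.2.2)}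
  let D : X → ℝ≥0∞ := fun S => volume (S.1.1 \ Metric.ball 0 a) +
    volume (S.1.2.1 \ Metric.ball 0 b) + volume (S.1.2.2 \ Metric.ball 0 c)
  have : Nonempty X := ⟨⟨(A, B, C), ⟨hA, hAR, hAa⟩, ⟨hB, hBR, hBb⟩, ⟨hC, hCR, hCc⟩, le_rfl⟩⟩
  have hδf : ∀ S : Set E, S ⊆ Metric.ball 0 R → ∀ ρ : ℝ, volume (S \ Metric.ball 0 ρ) ≠ ∞ :=
    fun S hS ρ => ((measure_mono (Set.sdiff_subset.trans hS)).trans_lt measure_ball_lt_top).ne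
  have hDfin : ∀ S : X, D S ≠ ∞ := by
    rintro ⟨⟨S₁, S₂, S₃⟩, h1, h2, h3, -⟩
    have e1 := hδf S₁ h1.2.1 a
    have e2 := hδf S₂ h2.2.1 b
    have e3 := hδf S₃ h3.2.1 c
    simp only [D]
    finiteness
  obtain ⟨k, hk, hstep⟩ := exists_symmetrization_step (n := n) hR
  have hstep' : ∀ x : X, ∃ y : X, D y + (k / 9) * D x ^ 2 ≤ D x := by
    rintro ⟨⟨S₁, S₂, S₃⟩, h1, h2, h3, h4⟩
    obtain ⟨T, hT1, hT2, hT3⟩ := hstep a b c ha haR hb hbR hc hcR S₁ S₂ S₃ h1.1 h2.1 h3.1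
      h1.2.1 h2.2.1 h3.2.1 h1.2.2 h2.2.2 h3.2.2
    have t1 := hT1 S₁ h1.1 h1.2.1
    have t2 := hT1 S₂ h2.1 h2.2.1
    have t3 := hT1 S₃ h3.1 h3.2.1
    refine ⟨⟨(T S₁, T S₂, T S₃), ⟨t1.1, t1.2.1, t1.2.2.trans h1.2.2⟩,
      ⟨t2.1, t2.2.1, t2.2.2.trans h2.2.2⟩, ⟨t3.1, t3.2.1, t3.2.2.trans h3.2.2⟩,
      h4.trans hT2⟩, le_trans ?_ hT3⟩
    simp only [D]
    refine add_le_add_right ?_ _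
    refine (mul_le_mul_right (add_add_sq_le_nine_mul _ _ _) _).trans_eq ?_
    rw [← mul_assoc, ENNReal.div_mul_cancel (by norm_num) (by norm_num)]
  have hk' : k / 9 ≠ 0 := (ENNReal.div_pos hk (by norm_num)).ne'
  set K := volume (Metric.ball (0 : E) R) with hK
  have hKt : K ≠ ∞ := measure_ball_lt_top.ne
  have hK0 : K ≠ 0 := (Metric.measure_ball_pos volume _ hR).ne'
  refine ENNReal.le_of_forall_pos_le_add fun η hη _ => ?_
  obtain ⟨⟨⟨S₁, S₂, S₃⟩, h1, h2, h3, h4⟩, hx⟩ := exists_lt_of_forall_exists_add_sq_le hDfin hk'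
    hstep' (ENNReal.div_pos (ENNReal.coe_ne_zero.2 hη.ne') hKt)
  have hx' : D ⟨(S₁, S₂, S₃), h1, h2, h3, h4⟩ * K ≤ η := by
    refine (mul_le_mul_left hx.le K).trans_eq ?_
    exact ENNReal.div_mul_cancel hK0 hKt
  refine h4.trans (le_trans ?_ (add_le_add_right hx' _))
  -- Each error set has one factor outside its ball, and its measure is at most that excess times
  -- `K`, the measure of the ball of radius `R`; together the errors are at most `D * K ≤ η`.
  have hcover : rieszSet S₁ S₂ S₃ ⊆
      rieszSet (Metric.ball (0 : E) a) (Metric.ball 0 b) (Metric.ball 0 c) ∪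
        (rieszSet (S₁ \ Metric.ball 0 a) S₂ S₃ ∪ rieszSet S₁ (S₂ \ Metric.ball 0 b) S₃ ∪
          rieszSet S₁ S₂ (S₃ \ Metric.ball 0 c)) := by
    rintro ⟨x, y⟩ ⟨g1, g2, g3⟩
    simp only at g1 g2 g3
    by_cases f1 : x ∈ Metric.ball (0 : E) a
    · by_cases f2 : y ∈ Metric.ball (0 : E) b
      · by_cases f3 : x + y ∈ Metric.ball (0 : E) c
        · exact Or.inl ⟨f1, f2, f3⟩
        · exact Or.inr (Or.inr ⟨g1, g2, g3, f3⟩)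
      · exact Or.inr (Or.inl (Or.inr ⟨g1, ⟨g2, f2⟩, g3⟩))
    · exact Or.inr (Or.inl (Or.inl ⟨⟨g1, f1⟩, g2, g3⟩))
  refine (measure_mono hcover).trans ((measure_union_le _ _).trans ?_)
  gcongr
  refine (measure_union_le _ _).trans ((add_le_add_left (measure_union_le _ _) _).trans ?_)
  simp only [D, add_mul]
  gcongr
  · exact (volume_rieszSet_le_mul_left _ _ _).trans (by gcongr; exact measure_mono h2.2.1)
  · refine (volume_rieszSet_le_mul_left _ _ _).trans ?_
    rw [mul_comm]
    gcongr
    exact measure_mono h1.2.1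
  · refine (volume_rieszSet_le_mul_fst h1.1 h2.1 (h3.1.diff measurableSet_ball)).trans ?_
    rw [mul_comm]
    gcongr
    exact measure_mono h1.2.1

theorem volume_ball_zero {r : ℝ} (hr : 0 ≤ r) :
    volume (Metric.ball (0 : EuclideanSpace ℝ (Fin (n + 1))) r) = ENNReal.ofReal (r ^ (n + 1)) *
      volume (Metric.ball (0 : EuclideanSpace ℝ (Fin (n + 1))) 1) := by
  rw [Measure.addHaar_ball _ _ hr]
  simp

theorem exists_volume_ball_eq {m : ℝ≥0∞} (hm : m ≠ ∞) :
    ∃ r, 0 ≤ r ∧ volume (Metric.ball (0 : EuclideanSpace ℝ (Fin (n + 1))) r) = m := by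
  set ω := volume (Metric.ball (0 : EuclideanSpace ℝ (Fin (n + 1))) 1)
  have hω0 : ω ≠ 0 := (Metric.measure_ball_pos volume _ one_pos).ne'
  have hωt : ω ≠ ∞ := measure_ball_lt_top.ne
  have hq : m / ω ≠ ∞ := ENNReal.div_ne_top hm hω0
  refine ⟨(m / ω).toReal ^ ((1 : ℝ) / (n + 1)), by positivity, ?_⟩
  rw [volume_ball_zero (by positivity), ← Real.rpow_natCast, ← Real.rpow_mul ENNReal.toReal_nonneg]
  have : (1 : ℝ) / (n + 1) * ((n + 1 : ℕ) : ℝ) = 1 := by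
    push_cast; field_simp
  rw [this, Real.rpow_one, ENNReal.ofReal_toReal hq, ENNReal.div_mul_cancel hω0 hωt]

theorem volume_ball_lt_volume_ball {r s : ℝ} (hr : 0 ≤ r) (hrs : r < s) :
    volume (Metric.ball (0 : EuclideanSpace ℝ (Fin (n + 1))) r) <
      volume (Metric.ball (0 : EuclideanSpace ℝ (Fin (n + 1))) s) := by
  rw [volume_ball_zero hr, volume_ball_zero (hr.trans hrs.le)]
  refine ENNReal.mul_lt_mul_left (Metric.measure_ball_pos volume _ one_pos).ne'
    measure_ball_lt_top.ne ?_
  exact ENNReal.ofReal_lt_ofReal_iff'.2 ⟨by gcongr, pow_pos (hr.trans_lt hrs) _⟩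

/-- The Riesz rearrangement inequality for sets of finite measure. -/
theorem volume_rieszSet_le_ball {a b c : ℝ} (ha : 0 ≤ a) (hb : 0 ≤ b) (hc : 0 ≤ c)
    {A B C : Set (EuclideanSpace ℝ (Fin (n + 1)))} (hA : MeasurableSet A) (hB : MeasurableSet B)
    (hC : MeasurableSet C)
    (hAa : volume A = volume (Metric.ball (0 : EuclideanSpace ℝ (Fin (n + 1))) a))
    (hBb : volume B = volume (Metric.ball (0 : EuclideanSpace ℝ (Fin (n + 1))) b))
    (hCc : volume C = volume (Metric.ball (0 : EuclideanSpace ℝ (Fin (n + 1))) c)) :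
    volume (rieszSet A B C) ≤
      volume (rieszSet (Metric.ball (0 : EuclideanSpace ℝ (Fin (n + 1))) a) (Metric.ball 0 b)
        (Metric.ball 0 c)) := by
  let E := EuclideanSpace ℝ (Fin (n + 1))
  -- Exhaustion by bounded truncations. The balls matching the truncated sets lie inside the
  -- original balls, so the bounded case suffices at each stage.
  have hU : rieszSet A B C = ⋃ N : ℕ, rieszSet (A ∩ Metric.ball 0 (N + 1 : ℝ))
      (B ∩ Metric.ball 0 (N + 1 : ℝ)) (C ∩ Metric.ball 0 (N + 1 : ℝ)) := by
    ext ⟨x, y⟩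
    simp only [rieszSet, Set.mem_ofPred_eq, Set.mem_iUnion, Set.mem_inter_iff, mem_ball_zero_iff]
    constructor
    · rintro ⟨h1, h2, h3⟩
      obtain ⟨N, hN⟩ := exists_nat_ge (max ‖x‖ (max ‖y‖ ‖x + y‖))
      simp only [max_le_iff] at hN
      exact ⟨N, ⟨h1, by linarith⟩, ⟨h2, by linarith⟩, h3, by linarith⟩
    · rintro ⟨N, h1, h2, h3⟩
      exact ⟨h1.1, h2.1, h3.1⟩
  have hmono : Monotone fun N : ℕ => rieszSet (A ∩ Metric.ball 0 (N + 1 : ℝ))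
      (B ∩ Metric.ball 0 (N + 1 : ℝ)) (C ∩ Metric.ball 0 (N + 1 : ℝ)) := by
    intro N N' h
    have h' : Metric.ball (0 : E) (N + 1 : ℝ) ⊆ Metric.ball 0 (N' + 1 : ℝ) :=
      Metric.ball_subset_ball (by gcongr)
    exact rieszSet_mono (Set.inter_subset_inter_right _ h') (Set.inter_subset_inter_right _ h')
      (Set.inter_subset_inter_right _ h')
  rw [hU, hmono.measure_iUnion]
  refine iSup_le fun N => ?_
  have hex : ∀ (S : Set E) (s : ℝ), 0 ≤ s → volume S = volume (Metric.ball (0 : E) s) →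
      ∃ r : ℝ, 0 ≤ r ∧ r ≤ N + 1 ∧ r ≤ s ∧
        volume (S ∩ Metric.ball 0 (N + 1 : ℝ)) = volume (Metric.ball (0 : E) r) := by
    intro S s hs hSs
    obtain ⟨r, hr, hrS⟩ := exists_volume_ball_eq (n := n)
      (measure_ne_top_of_subset (Set.inter_subset_left (s := S) (t := Metric.ball 0 (N + 1 : ℝ)))
        (hSs ▸ measure_ball_lt_top.ne))
    refine ⟨r, hr, ?_, ?_, hrS.symm⟩
    · by_contra! h
      refine (volume_ball_lt_volume_ball (n := n) (by positivity) h).not_ge ?_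
      rw [hrS]
      exact measure_mono Set.inter_subset_right
    · by_contra! h
      refine (volume_ball_lt_volume_ball (n := n) hs h).not_ge ?_
      rw [hrS, ← hSs]
      exact measure_mono Set.inter_subset_left
  obtain ⟨a', ha', haN, haa, hAa'⟩ := hex A a ha hAa
  obtain ⟨b', hb', hbN, hbb, hBb'⟩ := hex B b hb hBb
  obtain ⟨c', hc', hcN, hcc, hCc'⟩ := hex C c hc hCc
  refine (volume_rieszSet_le_ball_of_subset_ball (by positivity) ha' haN hb' hbN hc' hcN
    (hA.inter measurableSet_ball) (hB.inter measurableSet_ball) (hC.inter measurableSet_ball)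
    Set.inter_subset_right Set.inter_subset_right Set.inter_subset_right hAa' hBb' hCc').trans ?_
  exact measure_mono (rieszSet_mono (Metric.ball_subset_ball haa) (Metric.ball_subset_ball hbb)
    (Metric.ball_subset_ball hcc))

end RieszSets

/-! ### Integrals that depend only on distribution functions -/

section Equimeasurable

/-- Nothing is known about the measures of the zero sets, hence the restriction to positive values.
On each `(ε, ∞)` the image measures are finite and are determined by half-lines. -/
theorem restrict_Ioi_map_eq_of_volume_superlevel_eq {X Y : Type*} [MeasurableSpace X]
    [MeasurableSpace Y] {μ : Measure X} {ν : Measure Y} {f : X → ℝ} {g : Y → ℝ}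
    (hf : Measurable f) (hg : Measurable g)
    (hfg : ∀ l, 0 < l → μ {x | l < f x} = ν {x | l < g x})
    (hfin : ∀ l, 0 < l → μ {x | l < f x} ≠ ∞) :
    (μ.map f).restrict (Set.Ioi 0) = (ν.map g).restrict (Set.Ioi 0) := by
  have hU : (Set.Ioi (0 : ℝ)) = ⋃ k : ℕ, Set.Ioi (1 / ((k : ℝ) + 1)) := by
    ext x
    simp only [Set.mem_Ioi, Set.mem_iUnion]
    exact ⟨fun h => exists_nat_one_div_lt h, fun ⟨k, hk⟩ => lt_trans (by positivity) hk⟩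
  have hF : ∀ l, μ.map f (Set.Ioi l) = μ {x | l < f x} := fun l =>
    Measure.map_apply hf measurableSet_Ioi
  have hG : ∀ l, ν.map g (Set.Ioi l) = ν {x | l < g x} := fun l =>
    Measure.map_apply hg measurableSet_Ioi
  rw [hU, Measure.restrict_iUnion_congr]
  intro k
  set ε : ℝ := 1 / ((k : ℝ) + 1)
  have hε : 0 < ε := by positivity
  have : IsFiniteMeasure ((μ.map f).restrict (Set.Ioi ε)) :=
    ⟨by rw [Measure.restrict_apply_univ, hF]; exact (hfin ε hε).lt_top⟩
  refine Measure.ext_of_Iic _ _ fun a => ?_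
  rw [Measure.restrict_apply measurableSet_Iic, Measure.restrict_apply measurableSet_Iic]
  have hset : Set.Iic a ∩ Set.Ioi ε = Set.Ioi ε \ Set.Ioi (max a ε) := by
    ext x
    simp only [Set.mem_inter_iff, Set.mem_Iic, Set.mem_Ioi, Set.mem_sdiff, max_lt_iff, not_and,
      not_lt]
    constructor
    · rintro ⟨h1, h2⟩
      exact ⟨h2, fun h3 => absurd h1 (not_le.2 h3)⟩
    · rintro ⟨h1, h2⟩
      refine ⟨?_, h1⟩
      by_contra! h3
      exact absurd h1 (not_lt.2 (h2 h3))
  have hm : 0 < max a ε := hε.trans_le (le_max_right _ _)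
  rw [hset, measure_sdiff (Set.Ioi_subset_Ioi (le_max_right _ _))
      measurableSet_Ioi.nullMeasurableSet (by rw [hF]; exact hfin _ hm),
    measure_sdiff (Set.Ioi_subset_Ioi (le_max_right _ _))
      measurableSet_Ioi.nullMeasurableSet (by rw [hG, ← hfg _ hm]; exact hfin _ hm),
    hF, hF, hG, hG, hfg _ hε, hfg _ hm]

theorem lintegral_comp_eq_of_volume_superlevel_eq {X Y : Type*} [MeasurableSpace X]
    [MeasurableSpace Y] {μ : Measure X} {ν : Measure Y} {f : X → ℝ} {g : Y → ℝ}
    (hf : Measurable f) (hg : Measurable g) (hf0 : ∀ x, 0 ≤ f x) (hg0 : ∀ x, 0 ≤ g x)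
    (hfg : ∀ l, 0 < l → μ {x | l < f x} = ν {x | l < g x})
    (hfin : ∀ l, 0 < l → μ {x | l < f x} ≠ ∞) {ψ : ℝ → ℝ≥0∞} (hψ : Measurable ψ)
    (hψ0 : ψ 0 = 0) : ∫⁻ x, ψ (f x) ∂μ = ∫⁻ y, ψ (g y) ∂ν := by
  have key : ∀ y, 0 ≤ y → ψ y = (Set.Ioi 0).indicator ψ y := fun y hy => by
    rcases hy.eq_or_lt with rfl | h
    · simp [hψ0]
    · rw [Set.indicator_of_mem (Set.mem_Ioi.2 h)]
  have hi : Measurable ((Set.Ioi (0 : ℝ)).indicator ψ) := hψ.indicator measurableSet_Ioi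
  rw [lintegral_congr fun x => key (f x) (hf0 x), lintegral_congr fun x => key (g x) (hg0 x),
    ← lintegral_map hi hf, ← lintegral_map hi hg, lintegral_indicator measurableSet_Ioi,
    lintegral_indicator measurableSet_Ioi,
    restrict_Ioi_map_eq_of_volume_superlevel_eq hf hg hfg hfin]

/-- Tonelli, exchanging one function at a time; vanishing of `φ` on both axes makes the zero sets
irrelevant. -/
theorem lintegral_prod_comp_eq_of_volume_superlevel_eq {X Y : Type*} [MeasureSpace X]
    [MeasureSpace Y] [SFinite (volume : Measure X)] [SFinite (volume : Measure Y)]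
    {f f' : X → ℝ} {g g' : Y → ℝ} (hf : Measurable f) (hf' : Measurable f') (hg : Measurable g)
    (hg' : Measurable g') (hf0 : ∀ x, 0 ≤ f x) (hf0' : ∀ x, 0 ≤ f' x) (hg0 : ∀ x, 0 ≤ g x)
    (hg0' : ∀ x, 0 ≤ g' x)
    (hff : ∀ l, 0 < l → volume {x | l < f x} = volume {x | l < f' x})
    (hffin : ∀ l, 0 < l → volume {x | l < f x} ≠ ∞)
    (hgg : ∀ l, 0 < l → volume {x | l < g x} = volume {x | l < g' x})
    (hgfin : ∀ l, 0 < l → volume {x | l < g x} ≠ ∞) {φ : ℝ × ℝ → ℝ≥0∞} (hφ : Measurable φ)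
    (hφ1 : ∀ y, φ (0, y) = 0) (hφ2 : ∀ x, φ (x, 0) = 0) :
    ∫⁻ p : X × Y, φ (f p.1, g p.2) = ∫⁻ p : X × Y, φ (f' p.1, g' p.2) := by
  have m1 : Measurable fun p : X × Y => φ (f p.1, g p.2) := by fun_prop
  have m2 : Measurable fun p : X × Y => φ (f p.1, g' p.2) := by fun_prop
  have m3 : Measurable fun p : X × Y => φ (f' p.1, g' p.2) := by fun_prop
  have e1 : ∫⁻ p : X × Y, φ (f p.1, g p.2) = ∫⁻ p : X × Y, φ (f p.1, g' p.2) := by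
    rw [Measure.volume_eq_prod, lintegral_prod _ m1.aemeasurable, lintegral_prod _ m2.aemeasurable]
    exact lintegral_congr fun x => lintegral_comp_eq_of_volume_superlevel_eq hg hg' hg0 hg0' hgg
      hgfin (ψ := fun y => φ (f x, y)) (by fun_prop) (hφ2 _)
  have e2 : ∫⁻ p : X × Y, φ (f p.1, g' p.2) = ∫⁻ p : X × Y, φ (f' p.1, g' p.2) := by
    rw [Measure.volume_eq_prod, lintegral_prod_symm _ m2.aemeasurable,
      lintegral_prod_symm _ m3.aemeasurable]
    exact lintegral_congr fun y => lintegral_comp_eq_of_volume_superlevel_eq hf hf' hf0 hf0' hff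
      hffin (ψ := fun x => φ (x, g' y)) (by fun_prop) (hφ1 _)
  exact e1.trans e2

end Equimeasurable

/-! ### Level sets of the symmetric decreasing rearrangement -/

section Rearrangement

variable {n : ℕ} {f : EuclideanSpace ℝ (Fin (n + 1)) → ℝ}

theorem FiniteDistribution.volume_lt_ne_top {d : ℕ} {f : EuclideanSpace ℝ (Fin d) → ℝ}
    (hf : FiniteDistribution f) {l : ℝ} (hl : 0 < l) : volume {x | l < f x} ≠ ∞ :=
  ((measure_mono (t := {x | l ≤ f x}) fun x hx => le_of_lt (show l < f x from hx)).trans_lt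
    (hf l hl)).ne

theorem symmRearr_nonneg {d : ℕ} (f : EuclideanSpace ℝ (Fin d) → ℝ)
    (x : EuclideanSpace ℝ (Fin d)) : 0 ≤ symmRearr f x :=
  Real.sSup_nonneg fun _ hl => hl.1.le

theorem volume_superlevel_anti {d : ℕ} (f : EuclideanSpace ℝ (Fin d) → ℝ) {k l : ℝ}
    (hkl : k ≤ l) : volume {x | l < f x} ≤ volume {x | k < f x} :=
  measure_mono fun _ hx => lt_of_le_of_lt hkl hx

theorem exists_volume_superlevel_lt (hfm : Measurable f) (hf : FiniteDistribution f)
    {ε : ℝ≥0∞} (hε : 0 < ε) : ∃ l, volume {x | l < f x} < ε := by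
  have h : Filter.Tendsto (fun N : ℕ => volume {x | (N : ℝ) + 1 < f x}) Filter.atTop
      (nhds (volume (⋂ N : ℕ, {x | (N : ℝ) + 1 < f x}))) := by
    refine tendsto_measure_iInter_atTop
      (fun N => (measurableSet_lt measurable_const hfm).nullMeasurableSet) ?_
      ⟨0, hf.volume_lt_ne_top (by positivity)⟩
    intro N N' hN x hx
    have h1 : (N : ℝ) ≤ N' := by exact_mod_cast hN
    have h2 : (N' : ℝ) + 1 < f x := hx
    exact show (N : ℝ) + 1 < f x by linarith
  have h0 : ⋂ N : ℕ, {x | (N : ℝ) + 1 < f x} = ∅ := by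
    ext x
    simp only [Set.mem_iInter, Set.mem_ofPred_eq, Set.mem_empty_iff_false, iff_false, not_forall,
      not_lt]
    obtain ⟨N, hN⟩ := exists_nat_ge (f x)
    exact ⟨N, by linarith⟩
  rw [h0, measure_empty] at h
  obtain ⟨N, hN⟩ := (h.eventually (gt_mem_nhds hε)).exists
  exact ⟨_, hN⟩

/-- From right to left, continuity from below leaves room for a level strictly above `l`. The origin
is excluded because there the set of heights may be unbounded. -/
theorem lt_symmRearr_iff (hfm : Measurable f) (hf : FiniteDistribution f)
    {x : EuclideanSpace ℝ (Fin (n + 1))} (hx : x ≠ 0) {l : ℝ} (hl : 0 ≤ l) :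
    l < symmRearr f x ↔
      volume (Metric.ball (0 : EuclideanSpace ℝ (Fin (n + 1))) ‖x‖) < volume {y | l < f y} := by
  constructor
  · intro h
    -- Were the set empty, `sSup` would return `0`, which does not exceed `l`.
    have hne : {l : ℝ | 0 < l ∧ volume (Metric.ball (0 : EuclideanSpace ℝ (Fin (n + 1))) ‖x‖)
        < volume {y | l < f y}}.Nonempty := by
      by_contra! he
      rw [symmRearr, he, Real.sSup_empty] at h
      exact absurd hl (not_le.2 h)
    obtain ⟨k, hk, hlk⟩ := exists_lt_of_lt_csSup hne h
    exact hk.2.trans_le (volume_superlevel_anti f hlk.le)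
  · intro h
    have hU : {y | l < f y} = ⋃ k : ℕ, {y | l + 1 / ((k : ℝ) + 1) < f y} := by
      ext y
      simp only [Set.mem_ofPred_eq, Set.mem_iUnion]
      constructor
      · intro hy
        obtain ⟨k, hk⟩ := exists_nat_one_div_lt (sub_pos.2 hy)
        exact ⟨k, by linarith⟩
      · rintro ⟨k, hk⟩
        have : (0 : ℝ) < 1 / ((k : ℝ) + 1) := by positivity
        linarith
    have hmono : Monotone fun k : ℕ => {y | l + 1 / ((k : ℝ) + 1) < f y} := by
      intro k k' hk y hy
      have h1 : 1 / ((k' : ℝ) + 1) ≤ 1 / ((k : ℝ) + 1) := by gcongr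
      have h2 : l + 1 / ((k : ℝ) + 1) < f y := hy
      exact show l + 1 / ((k' : ℝ) + 1) < f y by linarith
    rw [hU, hmono.measure_iUnion] at h
    obtain ⟨k, hk⟩ := lt_iSup_iff.1 h
    have hpos : (0 : ℝ) < 1 / ((k : ℝ) + 1) := by positivity
    refine lt_of_lt_of_le (lt_add_of_pos_right l hpos) (le_csSup ?_ ⟨by linarith, hk⟩)
    -- An upper bound is needed for `sSup` to be a true supremum: high superlevel sets are smaller
    -- than the ball of radius `‖x‖ > 0`.
    obtain ⟨N, hN⟩ := exists_volume_superlevel_lt hfm hf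
      (Metric.measure_ball_pos volume (0 : EuclideanSpace ℝ (Fin (n + 1))) (norm_pos_iff.2 hx))
    refine ⟨N, fun m hm => ?_⟩
    by_contra! hNm
    exact absurd (hm.2.trans_le (volume_superlevel_anti f hNm.le)) (not_lt.2 hN.le)

theorem measurable_symmRearr (hfm : Measurable f) (hf : FiniteDistribution f) :
    Measurable (symmRearr f) := by
  refine measurable_of_Ioi fun l => ?_
  rcases lt_or_ge l 0 with hl | hl
  · convert MeasurableSet.univ
    exact Set.eq_univ_of_forall fun x => hl.trans_le (symmRearr_nonneg f x)
  have hvol : Measurable fun x : EuclideanSpace ℝ (Fin (n + 1)) =>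
      volume (Metric.ball (0 : EuclideanSpace ℝ (Fin (n + 1))) ‖x‖) := by
    simp_rw [volume_ball_zero (n := n) (norm_nonneg _)]
    fun_prop
  have h1 : MeasurableSet ((symmRearr f ⁻¹' Set.Ioi l) \ {0}) := by
    have h2 : (symmRearr f ⁻¹' Set.Ioi l) \ {0} =
        {x | volume (Metric.ball (0 : EuclideanSpace ℝ (Fin (n + 1))) ‖x‖) <
          volume {y | l < f y}} \ {0} := by
      ext x
      simp only [Set.mem_sdiff, Set.mem_preimage, Set.mem_Ioi, Set.mem_singleton_iff,
        Set.mem_ofPred_eq]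
      exact and_congr_left fun hx => lt_symmRearr_iff hfm hf hx hl
    rw [h2]
    exact (measurableSet_lt hvol measurable_const).diff (measurableSet_singleton 0)
  rw [← Set.sdiff_union_inter (symmRearr f ⁻¹' Set.Ioi l) {0}]
  exact h1.union (Set.Subsingleton.measurableSet
    (Set.subsingleton_singleton.anti Set.inter_subset_right))

/-- The superlevel sets of the rearrangement are centred balls, up to a null set. -/
theorem exists_superlevel_symmRearr_ae_eq_ball (hfm : Measurable f) (hf : FiniteDistribution f)
    {l : ℝ} (hl : 0 < l) :
    ∃ r, 0 ≤ r ∧ volume {x | l < f x} =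
        volume (Metric.ball (0 : EuclideanSpace ℝ (Fin (n + 1))) r) ∧
      ({x | l < symmRearr f x} : Set (EuclideanSpace ℝ (Fin (n + 1)))) =ᵐ[volume]
        Metric.ball 0 r := by
  obtain ⟨r, hr, hvol⟩ := exists_volume_ball_eq (n := n) (hf.volume_lt_ne_top hl)
  refine ⟨r, hr, hvol.symm, ?_⟩
  rw [Filter.eventuallyEq_set]
  filter_upwards [compl_mem_ae_iff.2 (measure_singleton (0 : EuclideanSpace ℝ (Fin (n + 1))))]
    with x hx
  rw [lt_symmRearr_iff hfm hf hx hl.le, ← hvol, mem_ball_zero_iff]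
  refine ⟨fun h => ?_, fun h => volume_ball_lt_volume_ball (norm_nonneg x) h⟩
  by_contra! h'
  exact absurd h (not_lt.2 (measure_mono (Metric.ball_subset_ball h')))

theorem volume_superlevel_symmRearr (hfm : Measurable f) (hf : FiniteDistribution f)
    {l : ℝ} (hl : 0 < l) : volume {x | l < symmRearr f x} = volume {x | l < f x} := by
  obtain ⟨r, -, h1, h2⟩ := exists_superlevel_symmRearr_ae_eq_ball hfm hf hl
  rw [h1, measure_congr h2]

theorem quasiMeasurePreserving_fst_add_snd {d : ℕ} : Measure.QuasiMeasurePreserving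
    (fun p : EuclideanSpace ℝ (Fin d) × EuclideanSpace ℝ (Fin d) => p.1 + p.2) volume volume :=
  Measure.quasiMeasurePreserving_snd.comp
    (measurePreserving_prod_add (volume : Measure (EuclideanSpace ℝ (Fin d)))
      volume).quasiMeasurePreserving

theorem rieszSet_ae_congr {d : ℕ} {A A' B B' C C' : Set (EuclideanSpace ℝ (Fin d))}
    (hA : A =ᵐ[volume] A') (hB : B =ᵐ[volume] B') (hC : C =ᵐ[volume] C') :
    rieszSet A B C =ᵐ[volume] rieszSet A' B' C' :=
  (Measure.quasiMeasurePreserving_fst.preimage_ae_eq hA).inter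
    ((Measure.quasiMeasurePreserving_snd.preimage_ae_eq hB).inter
      (quasiMeasurePreserving_fst_add_snd.preimage_ae_eq hC))

variable {g h : EuclideanSpace ℝ (Fin (n + 1)) → ℝ}

theorem volume_rieszSet_superlevel_le (hfm : Measurable f) (hf : FiniteDistribution f)
    (hgm : Measurable g) (hg : FiniteDistribution g) (hhm : Measurable h)
    (hh : FiniteDistribution h) {k l m : ℝ} (hk : 0 < k) (hl : 0 < l) (hm : 0 < m) :
    volume (rieszSet {x | k < f x} {x | l < g x} {x | m < h x}) ≤
      volume (rieszSet {x | k < symmRearr f x} {x | l < symmRearr g x}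
        {x | m < symmRearr h x}) := by
  obtain ⟨a, ha, ha1, ha2⟩ := exists_superlevel_symmRearr_ae_eq_ball hfm hf hk
  obtain ⟨b, hb, hb1, hb2⟩ := exists_superlevel_symmRearr_ae_eq_ball hgm hg hl
  obtain ⟨c, hc, hc1, hc2⟩ := exists_superlevel_symmRearr_ae_eq_ball hhm hh hm
  rw [measure_congr (rieszSet_ae_congr ha2 hb2 hc2)]
  exact volume_rieszSet_le_ball ha hb hc (measurableSet_lt measurable_const hfm)
    (measurableSet_lt measurable_const hgm) (measurableSet_lt measurable_const hhm) ha1 hb1 hc1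

end Rearrangement

/-! ### Grid approximation of the third difference -/

section Discretization

/-- The number of grid points `(i + 1) / N`, with `i < N ^ 2`, that lie strictly below `x`. -/
noncomputable def gridCount (N : ℕ) (x : ℝ) : ℕ := min (N ^ 2) (⌈x * N⌉₊ - 1)

/-- The ceiling minus one, rather than a floor, produces strict inequalities and hence open
superlevel conditions. The cap `N ^ 2` keeps sums finite while the grid reaches height `N`. -/
theorem lt_gridCount_iff {N : ℕ} (hN : 0 < N) (x : ℝ) (i : ℕ) :
    i < gridCount N x ↔ i < N ^ 2 ∧ ((i : ℝ) + 1) / N < x := by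
  have hN' : (0 : ℝ) < N := by exact_mod_cast hN
  rw [gridCount, lt_min_iff, div_lt_iff₀ hN']
  refine and_congr_right fun _ => ?_
  rw [Nat.lt_sub_iff_add_lt, Nat.lt_ceil]
  push_cast
  rfl

theorem gridCount_div_le {N : ℕ} (hN : 0 < N) {x : ℝ} (hx : 0 ≤ x) :
    (gridCount N x : ℝ) / N ≤ x := by
  rcases Nat.eq_zero_or_pos (gridCount N x) with h | h
  · simp [h, hx]
  · have h1 := ((lt_gridCount_iff hN x (gridCount N x - 1)).1 (by omega)).2
    rw [Nat.cast_sub h] at h1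
    simpa using h1.le

theorem tendsto_gridCount_div {x : ℝ} (hx : 0 ≤ x) :
    Filter.Tendsto (fun N : ℕ => (gridCount N x : ℝ) / N) Filter.atTop (nhds x) := by
  have h1 : Filter.Tendsto (fun N : ℕ => x - 1 / (N : ℝ)) Filter.atTop (nhds x) := by
    simpa using tendsto_const_nhds.sub (tendsto_one_div_atTop_nhds_zero_nat (𝕜 := ℝ))
  refine tendsto_of_tendsto_of_tendsto_of_le_of_le' h1 tendsto_const_nhds ?_ ?_
  · filter_upwards [Filter.eventually_gt_atTop 0, Filter.eventually_ge_atTop ⌈x⌉₊] with N hN hNx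
    have hN' : (0 : ℝ) < N := by exact_mod_cast hN
    have hxN : x ≤ N := Nat.ceil_le.1 hNx
    by_contra! hlt
    have h2 : ((gridCount N x : ℝ) + 1) / N < x := by rw [add_div]; linarith
    have h3 : gridCount N x < N ^ 2 := by
      have h4 : (gridCount N x : ℝ) + 1 < x * N := (div_lt_iff₀ hN').1 h2
      have h5 : x * N ≤ (N : ℝ) ^ 2 := by nlinarith
      have h6 : (gridCount N x : ℝ) < ((N ^ 2 : ℕ) : ℝ) := by push_cast; linarith
      exact_mod_cast h6
    exact lt_irrefl _ ((lt_gridCount_iff hN x _).2 ⟨h3, h2⟩)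
  · filter_upwards [Filter.eventually_gt_atTop 0] with N hN
    exact gridCount_div_le hN hx

theorem sum_range_gridCount {M : Type*} [AddCommMonoid M] {N : ℕ} (hN : 0 < N) (x : ℝ)
    (u : ℕ → M) : ∑ i ∈ Finset.range (gridCount N x), u i =
      ∑ i ∈ Finset.range (N ^ 2), if ((i : ℝ) + 1) / N < x then u i else 0 := by
  rw [← Finset.sum_filter]
  refine Finset.sum_congr ?_ fun _ _ => rfl
  ext i
  simp [lt_gridCount_iff hN]

/-- The third difference is additive in each of its three intervals, so the sum telescopes one
variable at a time. -/
theorem sum_thirdDiff (F : ℝ × ℝ × ℝ → ℝ) (t : ℕ → ℝ) (a b c : ℕ) :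
    ∑ i ∈ Finset.range a, ∑ j ∈ Finset.range b, ∑ k ∈ Finset.range c,
      thirdDiff F (t i) (t (i + 1)) (t j) (t (j + 1)) (t k) (t (k + 1)) =
    thirdDiff F (t 0) (t a) (t 0) (t b) (t 0) (t c) := by
  have h3 : ∀ a₁ a₂ b₁ b₂ : ℝ, ∑ k ∈ Finset.range c, thirdDiff F a₁ a₂ b₁ b₂ (t k) (t (k + 1)) =
      thirdDiff F a₁ a₂ b₁ b₂ (t 0) (t c) := by
    intro a₁ a₂ b₁ b₂
    induction c with
    | zero => rw [Finset.sum_range_zero]; unfold thirdDiff; ring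
    | succ c ih => rw [Finset.sum_range_succ, ih]; unfold thirdDiff; ring
  simp_rw [h3]
  have h2 : ∀ a₁ a₂ c₁ c₂ : ℝ, ∑ k ∈ Finset.range b, thirdDiff F a₁ a₂ (t k) (t (k + 1)) c₁ c₂ =
      thirdDiff F a₁ a₂ (t 0) (t b) c₁ c₂ := by
    intro a₁ a₂ b₁ b₂
    clear h3
    induction b with
    | zero => rw [Finset.sum_range_zero]; unfold thirdDiff; ring
    | succ c ih => rw [Finset.sum_range_succ, ih]; unfold thirdDiff; ring
  simp_rw [h2]
  clear h2 h3
  induction a with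
  | zero => rw [Finset.sum_range_zero]; unfold thirdDiff; ring
  | succ c ih => rw [Finset.sum_range_succ, ih]; unfold thirdDiff; ring

variable {F : ℝ × ℝ × ℝ → ℝ}

/-- The larger box is the smaller one together with three boxes, each of nonnegative third
difference. -/
theorem thirdDiff_zero_mono (hΔ : ∀ a₁ a₂ b₁ b₂ c₁ c₂ : ℝ, a₁ ≤ a₂ → b₁ ≤ b₂ → c₁ ≤ c₂ →
      0 ≤ thirdDiff F a₁ a₂ b₁ b₂ c₁ c₂) {x x' y y' z z' : ℝ} (hx : 0 ≤ x) (hx' : x ≤ x')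
    (hy : 0 ≤ y) (hy' : y ≤ y') (hz : 0 ≤ z) (hz' : z ≤ z') :
    thirdDiff F 0 x 0 y 0 z ≤ thirdDiff F 0 x' 0 y' 0 z' := by
  have h1 := hΔ x x' 0 y 0 z hx' hy hz
  have h2 := hΔ 0 x' y y' 0 z (hx.trans hx') hy' hz
  have h3 := hΔ 0 x' 0 y' z z' (hx.trans hx') (hy.trans hy') hz'
  have e1 : thirdDiff F 0 x' 0 y' 0 z' = thirdDiff F 0 x 0 y 0 z + thirdDiff F x x' 0 y 0 z +
      thirdDiff F 0 x' y y' 0 z + thirdDiff F 0 x' 0 y' z z' := by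
    unfold thirdDiff; ring
  linarith

/-- The discretized third difference of `F` over the box spanned by the origin and
`(x, y, z)`. -/
noncomputable def gridDiff (F : ℝ × ℝ × ℝ → ℝ) (N : ℕ) (x y z : ℝ) : ℝ :=
  thirdDiff F 0 (gridCount N x / N) 0 (gridCount N y / N) 0 (gridCount N z / N)

/-- A discrete layer-cake formula: the cell weights do not depend on `(x, y, z)`, which enters only
through superlevel conditions. -/
theorem ofReal_gridDiff (hΔ : ∀ a₁ a₂ b₁ b₂ c₁ c₂ : ℝ, a₁ ≤ a₂ → b₁ ≤ b₂ → c₁ ≤ c₂ →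
      0 ≤ thirdDiff F a₁ a₂ b₁ b₂ c₁ c₂) {N : ℕ} (hN : 0 < N) (x y z : ℝ) :
    ENNReal.ofReal (gridDiff F N x y z) = ∑ i ∈ Finset.range (N ^ 2), ∑ j ∈ Finset.range (N ^ 2),
      ∑ k ∈ Finset.range (N ^ 2),
        if ((i : ℝ) + 1) / N < x ∧ ((j : ℝ) + 1) / N < y ∧ ((k : ℝ) + 1) / N < z then
          ENNReal.ofReal (thirdDiff F (i / N) ((i + 1) / N) (j / N) ((j + 1) / N)
            (k / N) ((k + 1) / N)) else 0 := by
  have hw : ∀ i j k : ℕ, 0 ≤ thirdDiff F (i / N) ((i + 1) / N) (j / N) ((j + 1) / N)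
            (k / N) ((k + 1) / N) := fun i j k => by
    apply hΔ <;> gcongr <;> linarith
  have h := sum_thirdDiff F (fun i : ℕ => (i : ℝ) / N) (gridCount N x) (gridCount N y)
    (gridCount N z)
  simp only [Nat.cast_zero, zero_div, Nat.cast_add, Nat.cast_one] at h
  rw [gridDiff, ← h, ENNReal.ofReal_sum_of_nonneg fun i _ => Finset.sum_nonneg fun j _ =>
    Finset.sum_nonneg fun k _ => hw i j k, sum_range_gridCount hN]
  refine Finset.sum_congr rfl fun i _ => ?_
  rw [ENNReal.ofReal_sum_of_nonneg fun j _ => Finset.sum_nonneg fun k _ => hw i j k,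
    sum_range_gridCount hN]
  by_cases h1 : ((i : ℝ) + 1) / N < x
  swap
  · simp [h1]
  rw [if_pos h1]
  refine Finset.sum_congr rfl fun j _ => ?_
  rw [ENNReal.ofReal_sum_of_nonneg fun k _ => hw i j k, sum_range_gridCount hN]
  by_cases h2 : ((j : ℝ) + 1) / N < y
  swap
  · simp [h2]
  rw [if_pos h2]
  simp [h1, h2]

theorem gridDiff_le (hΔ : ∀ a₁ a₂ b₁ b₂ c₁ c₂ : ℝ, a₁ ≤ a₂ → b₁ ≤ b₂ → c₁ ≤ c₂ →
      0 ≤ thirdDiff F a₁ a₂ b₁ b₂ c₁ c₂) {N : ℕ} (hN : 0 < N) {x y z : ℝ} (hx : 0 ≤ x)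
    (hy : 0 ≤ y) (hz : 0 ≤ z) : gridDiff F N x y z ≤ thirdDiff F 0 x 0 y 0 z :=
  thirdDiff_zero_mono hΔ (by positivity) (gridCount_div_le hN hx) (by positivity)
    (gridCount_div_le hN hy) (by positivity) (gridCount_div_le hN hz)

theorem continuous_thirdDiff_zero (hF : Continuous F) :
    Continuous fun q : ℝ × ℝ × ℝ => thirdDiff F 0 q.1 0 q.2.1 0 q.2.2 := by
  unfold thirdDiff
  fun_prop

theorem tendsto_gridDiff (hF : Continuous F) {x y z : ℝ} (hx : 0 ≤ x) (hy : 0 ≤ y) (hz : 0 ≤ z) :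
    Filter.Tendsto (fun N => gridDiff F N x y z) Filter.atTop
      (nhds (thirdDiff F 0 x 0 y 0 z)) := by
  have h1 : Filter.Tendsto (fun N : ℕ => ((gridCount N x / N : ℝ), (gridCount N y / N : ℝ),
      (gridCount N z / N : ℝ))) Filter.atTop (nhds (x, y, z)) :=
    (tendsto_gridCount_div hx).prodMk_nhds
      ((tendsto_gridCount_div hy).prodMk_nhds (tendsto_gridCount_div hz))
  have h2 := ((continuous_thirdDiff_zero hF).tendsto (x, y, z)).comp h1
  simp only [Function.comp_def] at h2
  exact h2

end Discretization

/-! ### Rearrangement inequality for the third-difference term -/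

section TripleTerm

variable {n : ℕ} {F : ℝ × ℝ × ℝ → ℝ} {f g h : EuclideanSpace ℝ (Fin (n + 1)) → ℝ}

theorem measurableSet_rieszSet_superlevel {d : ℕ} {f g h : EuclideanSpace ℝ (Fin d) → ℝ}
    (hfm : Measurable f) (hgm : Measurable g) (hhm : Measurable h) (k l m : ℝ) :
    MeasurableSet (rieszSet {x | k < f x} {x | l < g x} {x | m < h x}) :=
  measurableSet_rieszSet (measurableSet_lt measurable_const hfm)
    (measurableSet_lt measurable_const hgm) (measurableSet_lt measurable_const hhm)

theorem lintegral_ofReal_gridDiff {d : ℕ} {f g h : EuclideanSpace ℝ (Fin d) → ℝ}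
    (hΔ : ∀ a₁ a₂ b₁ b₂ c₁ c₂ : ℝ, a₁ ≤ a₂ → b₁ ≤ b₂ → c₁ ≤ c₂ →
      0 ≤ thirdDiff F a₁ a₂ b₁ b₂ c₁ c₂) (hfm : Measurable f) (hgm : Measurable g)
    (hhm : Measurable h) {N : ℕ} (hN : 0 < N) :
    ∫⁻ p : EuclideanSpace ℝ (Fin d) × EuclideanSpace ℝ (Fin d),
      ENNReal.ofReal (gridDiff F N (f p.1) (g p.2) (h (p.1 + p.2))) =
    ∑ i ∈ Finset.range (N ^ 2), ∑ j ∈ Finset.range (N ^ 2), ∑ k ∈ Finset.range (N ^ 2),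
      ENNReal.ofReal (thirdDiff F (i / N) ((i + 1) / N) (j / N) ((j + 1) / N)
        (k / N) ((k + 1) / N)) *
      volume (rieszSet {x | ((i : ℝ) + 1) / N < f x} {x | ((j : ℝ) + 1) / N < g x}
        {x | ((k : ℝ) + 1) / N < h x}) := by
  have hind : ∀ p : EuclideanSpace ℝ (Fin d) × EuclideanSpace ℝ (Fin d),
      ENNReal.ofReal (gridDiff F N (f p.1) (g p.2) (h (p.1 + p.2))) =
      ∑ i ∈ Finset.range (N ^ 2), ∑ j ∈ Finset.range (N ^ 2), ∑ k ∈ Finset.range (N ^ 2),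
        (rieszSet {x | ((i : ℝ) + 1) / N < f x} {x | ((j : ℝ) + 1) / N < g x}
          {x | ((k : ℝ) + 1) / N < h x}).indicator (fun _ => ENNReal.ofReal (thirdDiff F (i / N)
          ((i + 1) / N) (j / N) ((j + 1) / N) (k / N) ((k + 1) / N))) p := by
    intro p
    rw [ofReal_gridDiff hΔ hN]
    refine Finset.sum_congr rfl fun i _ => Finset.sum_congr rfl fun j _ =>
      Finset.sum_congr rfl fun k _ => ?_
    by_cases hp : p ∈ rieszSet {x | ((i : ℝ) + 1) / N < f x} {x | ((j : ℝ) + 1) / N < g x}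
        {x | ((k : ℝ) + 1) / N < h x}
    · rw [Set.indicator_of_mem hp]
      exact if_pos hp
    · rw [Set.indicator_of_notMem hp]
      exact if_neg hp
  have hm : ∀ i j k : ℕ, Measurable
      ((rieszSet {x | ((i : ℝ) + 1) / N < f x} {x | ((j : ℝ) + 1) / N < g x}
          {x | ((k : ℝ) + 1) / N < h x}).indicator (fun _ => ENNReal.ofReal (thirdDiff F (i / N)
          ((i + 1) / N) (j / N) ((j + 1) / N) (k / N) ((k + 1) / N)))) := fun i j k =>
    measurable_const.indicator (measurableSet_rieszSet_superlevel hfm hgm hhm _ _ _)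
  simp_rw [hind]
  rw [lintegral_finsetSum _ fun i _ => Finset.measurable_fun_sum _ fun j _ =>
    Finset.measurable_fun_sum _ fun k _ => hm i j k]
  refine Finset.sum_congr rfl fun i _ => ?_
  rw [lintegral_finsetSum _ fun j _ => Finset.measurable_fun_sum _ fun k _ => hm i j k]
  refine Finset.sum_congr rfl fun j _ => ?_
  rw [lintegral_finsetSum _ fun k _ => hm i j k]
  refine Finset.sum_congr rfl fun k _ => ?_
  rw [lintegral_indicator (measurableSet_rieszSet_superlevel hfm hgm hhm _ _ _),
    setLIntegral_const]

theorem measurable_gridCount (N : ℕ) : Measurable (gridCount N) := by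
  unfold gridCount
  fun_prop

/-- The discretized inequality is the Riesz inequality cell by cell. In the limit the two sides are
treated differently: Fatou's lemma for `f`, `g`, `h`, and for the rearrangements the bound of the
grid difference by the full one. -/
theorem lintegral_thirdDiff_zero_le (hF : Continuous F)
    (hΔ : ∀ a₁ a₂ b₁ b₂ c₁ c₂ : ℝ, a₁ ≤ a₂ → b₁ ≤ b₂ → c₁ ≤ c₂ →
      0 ≤ thirdDiff F a₁ a₂ b₁ b₂ c₁ c₂)
    (hfm : Measurable f) (hgm : Measurable g) (hhm : Measurable h)
    (hf0 : ∀ x, 0 ≤ f x) (hg0 : ∀ x, 0 ≤ g x) (hh0 : ∀ x, 0 ≤ h x)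
    (hf : FiniteDistribution f) (hg : FiniteDistribution g) (hh : FiniteDistribution h) :
    ∫⁻ p : EuclideanSpace ℝ (Fin (n + 1)) × EuclideanSpace ℝ (Fin (n + 1)),
      ENNReal.ofReal (thirdDiff F 0 (f p.1) 0 (g p.2) 0 (h (p.1 + p.2))) ≤
    ∫⁻ p : EuclideanSpace ℝ (Fin (n + 1)) × EuclideanSpace ℝ (Fin (n + 1)),
      ENNReal.ofReal (thirdDiff F 0 (symmRearr f p.1) 0 (symmRearr g p.2) 0
        (symmRearr h (p.1 + p.2))) := by
  have hGm := (continuous_thirdDiff_zero hF).measurable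
  have hmeas : ∀ N, Measurable fun p : EuclideanSpace ℝ (Fin (n + 1)) ×
      EuclideanSpace ℝ (Fin (n + 1)) =>
      ENNReal.ofReal (gridDiff F N (f p.1) (g p.2) (h (p.1 + p.2))) := by
    intro N
    have hc : Measurable fun x : ℝ => (gridCount N x : ℝ) / N :=
      ((measurable_from_nat (f := fun i : ℕ => (i : ℝ))).comp (measurable_gridCount N)).div_const _
    have e1 : Measurable fun p : EuclideanSpace ℝ (Fin (n + 1)) × EuclideanSpace ℝ (Fin (n + 1)) =>
        (gridCount N (f p.1) : ℝ) / N := hc.comp (hfm.comp measurable_fst)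
    have e2 : Measurable fun p : EuclideanSpace ℝ (Fin (n + 1)) × EuclideanSpace ℝ (Fin (n + 1)) =>
        (gridCount N (g p.2) : ℝ) / N := hc.comp (hgm.comp measurable_snd)
    have e3 : Measurable fun p : EuclideanSpace ℝ (Fin (n + 1)) × EuclideanSpace ℝ (Fin (n + 1)) =>
        (gridCount N (h (p.1 + p.2)) : ℝ) / N :=
      hc.comp (hhm.comp (measurable_fst.add measurable_snd))
    exact (hGm.comp (e1.prodMk (e2.prodMk e3))).ennreal_ofReal
  have hlim : ∀ p : EuclideanSpace ℝ (Fin (n + 1)) × EuclideanSpace ℝ (Fin (n + 1)),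
      ENNReal.ofReal (thirdDiff F 0 (f p.1) 0 (g p.2) 0 (h (p.1 + p.2))) =
      Filter.liminf (fun N => ENNReal.ofReal (gridDiff F N (f p.1) (g p.2) (h (p.1 + p.2))))
        Filter.atTop := fun p =>
    (ENNReal.tendsto_ofReal (tendsto_gridDiff hF (hf0 _) (hg0 _) (hh0 _))).liminf_eq.symm
  rw [lintegral_congr hlim]
  refine (lintegral_liminf_le hmeas).trans ?_
  refine Filter.liminf_le_of_frequently_le' (Filter.Eventually.frequently ?_)
  filter_upwards [Filter.eventually_gt_atTop 0] with N hN
  rw [lintegral_ofReal_gridDiff hΔ hfm hgm hhm hN]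
  calc _ ≤ _ := Finset.sum_le_sum fun i _ => Finset.sum_le_sum fun j _ =>
        Finset.sum_le_sum fun k _ => mul_le_mul_right (volume_rieszSet_superlevel_le hfm hf hgm hg
          hhm hh (by positivity) (by positivity) (by positivity)) _
    _ = _ := (lintegral_ofReal_gridDiff hΔ (measurable_symmRearr hfm hf)
        (measurable_symmRearr hgm hg) (measurable_symmRearr hhm hh) hN).symm
    _ ≤ _ := lintegral_mono fun p => ENNReal.ofReal_le_ofReal (gridDiff_le hΔ hN
        (symmRearr_nonneg _ _) (symmRearr_nonneg _ _) (symmRearr_nonneg _ _))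

end TripleTerm

/-! ### Arithmetic of integrals with values in `(-∞, ∞]` -/

section ExtendedIntegral

/-- This is `x⁺ = x + x⁻` applied to the sum and its terms, with negative parts moved across so that
no subtraction occurs in `ℝ≥0∞`. -/
theorem ofReal_add_ofReal_neg_eq (a b c : ℝ) {d : ℝ} (hd : 0 ≤ d) :
    ENNReal.ofReal (a + b + c + d) +
        (ENNReal.ofReal (-a) + ENNReal.ofReal (-b) + ENNReal.ofReal (-c)) =
      ENNReal.ofReal (-(a + b + c + d)) +
        (ENNReal.ofReal a + ENNReal.ofReal b + ENNReal.ofReal c) + ENNReal.ofReal d := by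
  have key : ∀ x : ℝ, max x 0 = x + max (-x) 0 := fun x => by
    rcases le_total x 0 with h | h
    · rw [max_eq_right h, max_eq_left (neg_nonneg.2 h), add_neg_cancel]
    · rw [max_eq_left h, max_eq_right (neg_nonpos.2 h), add_zero]
  have hmax : ∀ x : ℝ, ENNReal.ofReal x = ENNReal.ofReal (max x 0) := fun x => by
    rcases le_total x 0 with h | h
    · rw [max_eq_right h, ENNReal.ofReal_of_nonpos h, ENNReal.ofReal_zero]
    · rw [max_eq_left h]
  have h0 : ∀ x : ℝ, 0 ≤ max x 0 := fun x => le_max_right _ _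
  rw [hmax (a + b + c + d), hmax (-a), hmax (-b), hmax (-c), hmax (-(a + b + c + d)), hmax a,
    hmax b, hmax c]
  have p1 := h0 (a + b + c + d)
  have p2 := h0 (-a)
  have p3 := h0 (-b)
  have p4 := h0 (-c)
  have p5 := h0 (-(a + b + c + d))
  have p6 := h0 a
  have p7 := h0 b
  have p8 := h0 c
  rw [← ENNReal.ofReal_add p2 p3, ← ENNReal.ofReal_add (add_nonneg p2 p3) p4,
    ← ENNReal.ofReal_add p1 (by positivity), ← ENNReal.ofReal_add p6 p7,
    ← ENNReal.ofReal_add (add_nonneg p6 p7) p8, ← ENNReal.ofReal_add p5 (by positivity),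
    ← ENNReal.ofReal_add (by positivity) hd]
  congr 1
  rw [key (a + b + c + d), key a, key b, key c]
  ring

variable {X : Type*} [MeasureSpace X] {a b c d : X → ℝ}

theorem lintegral_ofReal_add_negIntegral_eq (ha : Measurable a) (hb : Measurable b)
    (hc : Measurable c) (hd : Measurable d) (hd0 : ∀ p, 0 ≤ d p) :
    (∫⁻ p, ENNReal.ofReal (a p + b p + c p + d p)) +
        (negIntegral a + negIntegral b + negIntegral c) =
      negIntegral (fun p => a p + b p + c p + d p) +
        ((∫⁻ p, ENNReal.ofReal (a p)) + (∫⁻ p, ENNReal.ofReal (b p)) +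
          ∫⁻ p, ENNReal.ofReal (c p)) + ∫⁻ p, ENNReal.ofReal (d p) := by
  unfold negIntegral
  rw [← lintegral_add_left (by fun_prop), ← lintegral_add_left (by fun_prop),
    ← lintegral_add_left (by fun_prop), ← lintegral_add_left (by fun_prop),
    ← lintegral_add_left (by fun_prop), ← lintegral_add_left (by fun_prop),
    ← lintegral_add_left (by fun_prop)]
  exact lintegral_congr fun p => ofReal_add_ofReal_neg_eq _ _ _ (hd0 p)

theorem negIntegral_add_le (ha : Measurable a) (hb : Measurable b) (hd0 : ∀ p, 0 ≤ d p) :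
    negIntegral (fun p => a p + b p + c p + d p) ≤
      negIntegral a + negIntegral b + negIntegral c := by
  unfold negIntegral
  rw [← lintegral_add_left (by fun_prop), ← lintegral_add_left (by fun_prop)]
  refine lintegral_mono fun p => ?_
  calc ENNReal.ofReal (-(a p + b p + c p + d p))
      ≤ ENNReal.ofReal (-a p + -b p + -c p) := ENNReal.ofReal_le_ofReal (by linarith [hd0 p])
    _ ≤ _ := ENNReal.ofReal_add_le.trans (add_le_add_left ENNReal.ofReal_add_le _)

/-- Here `S` and `N` are the common positive and negative totals of the pair terms, and `γ`, `γ'`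
the third-difference integrals. If `P' = ∞` the right side is `∞`; otherwise every quantity is
finite and the claim is linear arithmetic. -/
theorem EReal.coe_sub_coe_le_of_add_eq {P M P' M' N S γ γ' : ℝ≥0∞} (hN : N ≠ ∞) (hM : M ≠ ∞)
    (hM' : M' ≠ ∞) (h : P + N = M + S + γ) (h' : P' + N = M' + S + γ') (hγ : γ ≤ γ') :
    (P : EReal) - (M : EReal) ≤ (P' : EReal) - (M' : EReal) := by
  lift M to NNReal using hM
  lift M' to NNReal using hM'
  lift N to NNReal using hN
  by_cases hP' : P' = ∞
  · rw [hP', EReal.coe_ennreal_top, EReal.coe_nnreal_eq_coe_real M']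
    exact le_top.trans_eq (EReal.top_sub_coe (M' : ℝ)).symm
  have hfin : (M' : ℝ≥0∞) + S + γ' ≠ ∞ := by
    rw [← h']
    exact ENNReal.add_ne_top.2 ⟨hP', ENNReal.coe_ne_top⟩
  rw [ENNReal.add_ne_top, ENNReal.add_ne_top] at hfin
  have hS := hfin.1.2
  have hγ' := hfin.2
  have hγf : γ ≠ ∞ := (hγ.trans_lt hγ'.lt_top).ne
  have hP : P ≠ ∞ := by
    have : P + N ≠ ∞ := by rw [h]; finiteness
    exact (ENNReal.add_ne_top.1 this).1
  lift P to NNReal using hP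
  lift P' to NNReal using hP'
  lift S to NNReal using hS
  lift γ to NNReal using hγf
  lift γ' to NNReal using hγ'
  norm_cast at h h' hγ
  simp only [EReal.coe_nnreal_eq_coe_real]
  rw [← EReal.coe_sub, ← EReal.coe_sub, EReal.coe_le_coe_iff]
  have e1 : (P : ℝ) + N = M + S + γ := by exact_mod_cast h
  have e2 : (P' : ℝ) + N = M' + S + γ' := by exact_mod_cast h'
  have e3 : (γ : ℝ) ≤ γ' := by exact_mod_cast hγ
  linarith

theorem negIntegral_congr_ae {φ ψ : X → ℝ} (h : φ =ᵐ[volume] ψ) :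
    negIntegral φ = negIntegral ψ :=
  lintegral_congr_ae (h.mono fun p hp => by simp only [hp])

theorem extIntegral_congr_ae {φ ψ : X → ℝ} (h : φ =ᵐ[volume] ψ) :
    extIntegral φ = extIntegral ψ := by
  unfold extIntegral
  have e : ∫⁻ p, ENNReal.ofReal (φ p) = ∫⁻ p, ENNReal.ofReal (ψ p) :=
    lintegral_congr_ae (h.fun_comp ENNReal.ofReal)
  rw [negIntegral_congr_ae h, e]

end ExtendedIntegral

/-! ### Pair terms, and the inequality for Borel functions -/

section TripleIntegrand

variable {F : ℝ × ℝ × ℝ → ℝ}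

theorem tripleIntegrand_ae_congr {d : ℕ} {f f' g g' h h' : EuclideanSpace ℝ (Fin d) → ℝ}
    (hf : f =ᵐ[volume] f') (hg : g =ᵐ[volume] g') (hh : h =ᵐ[volume] h') :
    tripleIntegrand F f g h =ᵐ[volume] tripleIntegrand F f' g' h' := by
  filter_upwards [Measure.quasiMeasurePreserving_fst.ae hf,
    Measure.quasiMeasurePreserving_snd.ae hg, quasiMeasurePreserving_fst_add_snd.ae hh]
    with p h1 h2 h3
  simp only [tripleIntegrand, h1, h2, h3]

theorem symmRearr_congr_ae {d : ℕ} {f f' : EuclideanSpace ℝ (Fin d) → ℝ}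
    (hf : f =ᵐ[volume] f') : symmRearr f = symmRearr f' := by
  have h : ∀ l : ℝ, volume {y | l < f y} = volume {y | l < f' y} := fun l =>
    measure_congr (hf.mono fun x hx => by
      change (l < f x) = (l < f' x)
      rw [hx])
  funext x
  simp only [symmRearr, h]

theorem exists_measurable_nonneg_ae_eq {d : ℕ} {f : EuclideanSpace ℝ (Fin d) → ℝ}
    (hfm : AEMeasurable f volume) (hf0 : ∀ x, 0 ≤ f x) (hf : FiniteDistribution f) :
    ∃ f' : EuclideanSpace ℝ (Fin d) → ℝ, Measurable f' ∧ (∀ x, 0 ≤ f' x) ∧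
      FiniteDistribution f' ∧ f =ᵐ[volume] f' := by
  -- The measurable representative may be negative on a null set, hence the maximum with `0`.
  have hae : f =ᵐ[volume] fun x => max (hfm.mk f x) 0 :=
    hfm.ae_eq_mk.mono fun x hx => by
      change f x = max (hfm.mk f x) 0
      rw [← hx, max_eq_left (hf0 x)]
  refine ⟨fun x => max (hfm.mk f x) 0, hfm.measurable_mk.max measurable_const,
    fun x => le_max_right _ _, fun l hl => ?_, hae⟩
  refine lt_of_eq_of_lt (measure_congr (hae.mono fun x hx => ?_)) (hf l hl)
  change (l ≤ max (hfm.mk f x) 0) = (l ≤ f x)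
  rw [hx]

theorem measurable_tripleIntegrand {d : ℕ} (hF : Continuous F)
    {f g h : EuclideanSpace ℝ (Fin d) → ℝ} (hf : Measurable f) (hg : Measurable g)
    (hh : Measurable h) : Measurable (tripleIntegrand F f g h) :=
  hF.measurable.comp ((hf.comp measurable_fst).prodMk ((hg.comp measurable_snd).prodMk
    (hh.comp (measurable_fst.add measurable_snd))))

/-- Expanding the third difference from the origin, the values on the axes drop out and only the
pair terms have to be restored. -/
theorem tripleIntegrand_eq_add {d : ℕ} (hx : ∀ x : ℝ, F (x, 0, 0) = 0)
    (hy : ∀ y : ℝ, F (0, y, 0) = 0) (hz : ∀ z : ℝ, F (0, 0, z) = 0)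
    (f g h : EuclideanSpace ℝ (Fin d) → ℝ) :
    tripleIntegrand F f g h = fun p => tripleIntegrand F f g 0 p + tripleIntegrand F f 0 h p +
      tripleIntegrand F 0 g h p + thirdDiff F 0 (f p.1) 0 (g p.2) 0 (h (p.1 + p.2)) := by
  funext p
  simp only [tripleIntegrand, thirdDiff, Pi.zero_apply, hx, hy, hz]
  ring

variable {n : ℕ} {f g h : EuclideanSpace ℝ (Fin (n + 1)) → ℝ}

theorem lintegral_pair_symmRearr (hfm : Measurable f) (hgm : Measurable g)
    (hf0 : ∀ x, 0 ≤ f x) (hg0 : ∀ x, 0 ≤ g x) (hf : FiniteDistribution f)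
    (hg : FiniteDistribution g) {φ : ℝ × ℝ → ℝ≥0∞} (hφ : Measurable φ)
    (hφ1 : ∀ y, φ (0, y) = 0) (hφ2 : ∀ x, φ (x, 0) = 0) :
    ∫⁻ p : EuclideanSpace ℝ (Fin (n + 1)) × EuclideanSpace ℝ (Fin (n + 1)), φ (f p.1, g p.2) =
    ∫⁻ p : EuclideanSpace ℝ (Fin (n + 1)) × EuclideanSpace ℝ (Fin (n + 1)),
      φ (symmRearr f p.1, symmRearr g p.2) :=
  lintegral_prod_comp_eq_of_volume_superlevel_eq hfm (measurable_symmRearr hfm hf) hgm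
    (measurable_symmRearr hgm hg) hf0 (symmRearr_nonneg f) hg0 (symmRearr_nonneg g)
    (fun _ hl => (volume_superlevel_symmRearr hfm hf hl).symm) (fun _ hl => hf.volume_lt_ne_top hl)
    (fun _ hl => (volume_superlevel_symmRearr hgm hg hl).symm) (fun _ hl => hg.volume_lt_ne_top hl)
    hφ hφ1 hφ2

theorem lintegral_comp_fst_add {d : ℕ} {f h : EuclideanSpace ℝ (Fin d) → ℝ} (hfm : Measurable f)
    (hhm : Measurable h) {φ : ℝ × ℝ → ℝ≥0∞} (hφ : Measurable φ) :
    ∫⁻ p : EuclideanSpace ℝ (Fin d) × EuclideanSpace ℝ (Fin d), φ (f p.1, h (p.1 + p.2)) =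
    ∫⁻ p : EuclideanSpace ℝ (Fin d) × EuclideanSpace ℝ (Fin d), φ (f p.1, h p.2) :=
  (measurePreserving_prod_add (volume : Measure (EuclideanSpace ℝ (Fin d)))
    volume).lintegral_comp (f := fun p => φ (f p.1, h p.2))
    (hφ.comp ((hfm.comp measurable_fst).prodMk (hhm.comp measurable_snd)))

theorem lintegral_comp_snd_add {d : ℕ} {g h : EuclideanSpace ℝ (Fin d) → ℝ} (hgm : Measurable g)
    (hhm : Measurable h) {φ : ℝ × ℝ → ℝ≥0∞} (hφ : Measurable φ) :
    ∫⁻ p : EuclideanSpace ℝ (Fin d) × EuclideanSpace ℝ (Fin d), φ (g p.2, h (p.1 + p.2)) =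
    ∫⁻ p : EuclideanSpace ℝ (Fin d) × EuclideanSpace ℝ (Fin d), φ (g p.1, h p.2) :=
  (measurePreserving_prod_add_swap_right (volume : Measure (EuclideanSpace ℝ (Fin d)))
    volume).lintegral_comp (f := fun p => φ (g p.1, h p.2))
    (hφ.comp ((hgm.comp measurable_fst).prodMk (hhm.comp measurable_snd)))

/-- A shear turns `s + t` into an independent variable; vanishing of `F` on the axes then allows the
equimeasurable exchange. -/
theorem lintegral_ofReal_tripleIntegrand_zero_symmRearr (hF : Continuous F)
    (hx : ∀ x : ℝ, F (x, 0, 0) = 0) (hy : ∀ y : ℝ, F (0, y, 0) = 0)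
    (hz : ∀ z : ℝ, F (0, 0, z) = 0) (hfm : Measurable f) (hgm : Measurable g)
    (hhm : Measurable h) (hf0 : ∀ x, 0 ≤ f x) (hg0 : ∀ x, 0 ≤ g x) (hh0 : ∀ x, 0 ≤ h x)
    (hf : FiniteDistribution f) (hg : FiniteDistribution g) (hh : FiniteDistribution h) :
    (∫⁻ p, ENNReal.ofReal (tripleIntegrand F f g 0 p) =
      ∫⁻ p, ENNReal.ofReal (tripleIntegrand F (symmRearr f) (symmRearr g) 0 p)) ∧
    (∫⁻ p, ENNReal.ofReal (tripleIntegrand F f 0 h p) =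
      ∫⁻ p, ENNReal.ofReal (tripleIntegrand F (symmRearr f) 0 (symmRearr h) p)) ∧
    (∫⁻ p, ENNReal.ofReal (tripleIntegrand F 0 g h p) =
      ∫⁻ p, ENNReal.ofReal (tripleIntegrand F 0 (symmRearr g) (symmRearr h) p)) := by
  have hfm' := measurable_symmRearr hfm hf
  have hgm' := measurable_symmRearr hgm hg
  have hhm' := measurable_symmRearr hhm hh
  refine ⟨?_, ?_, ?_⟩
  · exact lintegral_pair_symmRearr hfm hgm hf0 hg0 hf hg
      (φ := fun q => ENNReal.ofReal (F (q.1, q.2, 0))) (by fun_prop) (by simp [hy]) (by simp [hx])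
  · have hφ : Measurable fun q : ℝ × ℝ => ENNReal.ofReal (F (q.1, 0, q.2)) := by fun_prop
    exact (lintegral_comp_fst_add hfm hhm hφ).trans ((lintegral_pair_symmRearr hfm hhm hf0 hh0 hf hh
      hφ (by simp [hz]) (by simp [hx])).trans (lintegral_comp_fst_add hfm' hhm' hφ).symm)
  · have hφ : Measurable fun q : ℝ × ℝ => ENNReal.ofReal (F (0, q.1, q.2)) := by fun_prop
    exact (lintegral_comp_snd_add hgm hhm hφ).trans ((lintegral_pair_symmRearr hgm hhm hg0 hh0 hg hh
      hφ (by simp [hz]) (by simp [hy])).trans (lintegral_comp_snd_add hgm' hhm' hφ).symm)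

theorem extIntegral_tripleIntegrand_le_symmRearr (hF : Continuous F)
    (hx : ∀ x : ℝ, F (x, 0, 0) = 0) (hy : ∀ y : ℝ, F (0, y, 0) = 0)
    (hz : ∀ z : ℝ, F (0, 0, z) = 0)
    (hΔ : ∀ a₁ a₂ b₁ b₂ c₁ c₂ : ℝ, a₁ ≤ a₂ → b₁ ≤ b₂ → c₁ ≤ c₂ →
      0 ≤ thirdDiff F a₁ a₂ b₁ b₂ c₁ c₂)
    (hfm : Measurable f) (hgm : Measurable g) (hhm : Measurable h)
    (hf0 : ∀ x, 0 ≤ f x) (hg0 : ∀ x, 0 ≤ g x) (hh0 : ∀ x, 0 ≤ h x)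
    (hf : FiniteDistribution f) (hg : FiniteDistribution g) (hh : FiniteDistribution h)
    (hfg : negIntegral (tripleIntegrand F f g 0) < ∞)
    (hfh : negIntegral (tripleIntegrand F f 0 h) < ∞)
    (hgh : negIntegral (tripleIntegrand F 0 g h) < ∞) :
    negIntegral (tripleIntegrand F f g h) < ∞ ∧
    negIntegral (tripleIntegrand F (symmRearr f) (symmRearr g) (symmRearr h)) < ∞ ∧
    extIntegral (tripleIntegrand F f g h)
      ≤ extIntegral (tripleIntegrand F (symmRearr f) (symmRearr g) (symmRearr h)) := by
  have hfm' := measurable_symmRearr hfm hf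
  have hgm' := measurable_symmRearr hgm hg
  have hhm' := measurable_symmRearr hhm hh
  obtain ⟨p1, p2, p3⟩ := lintegral_ofReal_tripleIntegrand_zero_symmRearr hF hx hy hz hfm hgm hhm
    hf0 hg0 hh0 hf hg hh
  -- The lemma uses no sign of the third difference, so it applies to `-F` and gives the same
  -- invariance for the negative parts.
  obtain ⟨n1, n2, n3⟩ := lintegral_ofReal_tripleIntegrand_zero_symmRearr (F := fun q => -F q)
    hF.neg (by simp [hx]) (by simp [hy]) (by simp [hz]) hfm hgm hhm hf0 hg0 hh0 hf hg hh
  have n1' : negIntegral (tripleIntegrand F f g 0) =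
    negIntegral (tripleIntegrand F (symmRearr f) (symmRearr g) 0) := n1
  have n2' : negIntegral (tripleIntegrand F f 0 h) =
    negIntegral (tripleIntegrand F (symmRearr f) 0 (symmRearr h)) := n2
  have n3' : negIntegral (tripleIntegrand F 0 g h) =
    negIntegral (tripleIntegrand F 0 (symmRearr g) (symmRearr h)) := n3
  have m0 : Measurable (0 : EuclideanSpace ℝ (Fin (n + 1)) → ℝ) := measurable_const
  have hGm : ∀ {f g h : EuclideanSpace ℝ (Fin (n + 1)) → ℝ}, Measurable f → Measurable g →
      Measurable h → Measurable fun p : EuclideanSpace ℝ (Fin (n + 1)) ×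
        EuclideanSpace ℝ (Fin (n + 1)) => thirdDiff F 0 (f p.1) 0 (g p.2) 0 (h (p.1 + p.2)) :=
    fun {f g h} hfm hgm hhm => measurable_tripleIntegrand
      (F := fun q => thirdDiff F 0 q.1 0 q.2.1 0 q.2.2) (continuous_thirdDiff_zero hF) hfm hgm hhm
  have hG0 : ∀ x y z : ℝ, 0 ≤ x → 0 ≤ y → 0 ≤ z → 0 ≤ thirdDiff F 0 x 0 y 0 z :=
    fun x y z h1 h2 h3 => hΔ 0 x 0 y 0 z h1 h2 h3
  have e := lintegral_ofReal_add_negIntegral_eq (measurable_tripleIntegrand hF hfm hgm m0)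
    (measurable_tripleIntegrand hF hfm m0 hhm) (measurable_tripleIntegrand hF m0 hgm hhm)
    (hGm hfm hgm hhm) fun p => hG0 _ _ _ (hf0 _) (hg0 _) (hh0 _)
  have e' := lintegral_ofReal_add_negIntegral_eq (measurable_tripleIntegrand hF hfm' hgm' m0)
    (measurable_tripleIntegrand hF hfm' m0 hhm') (measurable_tripleIntegrand hF m0 hgm' hhm')
    (hGm hfm' hgm' hhm') fun p => hG0 _ _ _ (symmRearr_nonneg f _) (symmRearr_nonneg g _)
      (symmRearr_nonneg h _)
  have b := negIntegral_add_le (c := tripleIntegrand F 0 g h)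
    (measurable_tripleIntegrand hF hfm hgm m0) (measurable_tripleIntegrand hF hfm m0 hhm)
    fun p => hG0 (f p.1) (g p.2) (h (p.1 + p.2)) (hf0 _) (hg0 _) (hh0 _)
  have b' := negIntegral_add_le (c := tripleIntegrand F 0 (symmRearr g) (symmRearr h))
    (measurable_tripleIntegrand hF hfm' hgm' m0) (measurable_tripleIntegrand hF hfm' m0 hhm')
    fun p => hG0 (symmRearr f p.1) (symmRearr g p.2) (symmRearr h (p.1 + p.2))
      (symmRearr_nonneg f _) (symmRearr_nonneg g _) (symmRearr_nonneg h _)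
  rw [← tripleIntegrand_eq_add hx hy hz] at b b'
  have hN : negIntegral (tripleIntegrand F f g 0) + negIntegral (tripleIntegrand F f 0 h) +
      negIntegral (tripleIntegrand F 0 g h) < ∞ :=
    ENNReal.add_lt_top.2 ⟨ENNReal.add_lt_top.2 ⟨hfg, hfh⟩, hgh⟩
  rw [← n1', ← n2', ← n3'] at b' e'
  rw [← p1, ← p2, ← p3] at e'
  have hM := b.trans_lt hN
  have hM' := b'.trans_lt hN
  refine ⟨hM, hM', ?_⟩
  rw [← tripleIntegrand_eq_add hx hy hz] at e e'
  have t := tripleIntegrand_eq_add hx hy hz f g h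
  have t' := tripleIntegrand_eq_add hx hy hz (symmRearr f) (symmRearr g) (symmRearr h)
  simp_rw [← congrFun t _] at e
  simp_rw [← congrFun t' _] at e'
  exact EReal.coe_sub_coe_le_of_add_eq hN.ne hM.ne hM'.ne e e'
    (lintegral_thirdDiff_zero_le hF hΔ hfm hgm hhm hf0 hg0 hh0 hf hg hh)

end TripleIntegrand

/-! ### The theorem, by passage to Borel representatives -/

theorem theorem3 {d : ℕ} (hd : 0 < d)
    (F : ℝ × ℝ × ℝ → ℝ) (hF : Continuous F)
    (hx : ∀ x : ℝ, F (x, 0, 0) = 0)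
    (hy : ∀ y : ℝ, F (0, y, 0) = 0)
    (hz : ∀ z : ℝ, F (0, 0, z) = 0)
    (hΔ : ∀ a₁ a₂ b₁ b₂ c₁ c₂ : ℝ, a₁ ≤ a₂ → b₁ ≤ b₂ → c₁ ≤ c₂ →
      0 ≤ thirdDiff F a₁ a₂ b₁ b₂ c₁ c₂)
    (f g h : EuclideanSpace ℝ (Fin d) → ℝ)
    (hfm : AEMeasurable f volume) (hgm : AEMeasurable g volume) (hhm : AEMeasurable h volume)
    (hf0 : ∀ x, 0 ≤ f x) (hg0 : ∀ x, 0 ≤ g x) (hh0 : ∀ x, 0 ≤ h x)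
    (hf : FiniteDistribution f) (hg : FiniteDistribution g) (hh : FiniteDistribution h)
    -- the integrals of `F(f(s), g(t), 0)`, `F(f(s), 0, h(s + t))` and `F(0, g(t), h(s + t))`
    -- are well defined, with values in `(-∞, ∞]` (automatic if `F ≥ 0` on the octant)
    (hfg : negIntegral (tripleIntegrand F f g 0) < ∞)
    (hfh : negIntegral (tripleIntegrand F f 0 h) < ∞)
    (hgh : negIntegral (tripleIntegrand F 0 g h) < ∞) :
    negIntegral (tripleIntegrand F f g h) < ∞ ∧
    negIntegral (tripleIntegrand F (symmRearr f) (symmRearr g) (symmRearr h)) < ∞ ∧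
    extIntegral (tripleIntegrand F f g h)
      ≤ extIntegral (tripleIntegrand F (symmRearr f) (symmRearr g) (symmRearr h)) := by
  obtain ⟨n, rfl⟩ : ∃ n, d = n + 1 := ⟨d - 1, by omega⟩
  obtain ⟨f', hfm', hf0', hf', hff⟩ := exists_measurable_nonneg_ae_eq hfm hf0 hf
  obtain ⟨g', hgm', hg0', hg', hgg⟩ := exists_measurable_nonneg_ae_eq hgm hg0 hg
  obtain ⟨h', hhm', hh0', hh', hhh⟩ := exists_measurable_nonneg_ae_eq hhm hh0 hh
  rw [negIntegral_congr_ae (tripleIntegrand_ae_congr hff hgg (ae_eq_refl 0))] at hfg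
  rw [negIntegral_congr_ae (tripleIntegrand_ae_congr hff (ae_eq_refl 0) hhh)] at hfh
  rw [negIntegral_congr_ae (tripleIntegrand_ae_congr (ae_eq_refl 0) hgg hhh)] at hgh
  rw [negIntegral_congr_ae (tripleIntegrand_ae_congr hff hgg hhh),
    extIntegral_congr_ae (tripleIntegrand_ae_congr hff hgg hhh), symmRearr_congr_ae hff,
    symmRearr_congr_ae hgg, symmRearr_congr_ae hhh]
  exact extIntegral_tripleIntegrand_le_symmRearr hF hx hy hz hΔ hfm' hgm' hhm' hf0' hg0' hh0'
    hf' hg' hh' hfg hfh hgh
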